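/- Let $T$ be a finite metric tree with at least two vertices, all of whose edges have the same length $l>0$, rooted at an arbitrary vertex $v_0$. Direct all edges away from $v_0$ and identify each edge $e_j$ with $[0,l]$ accordingly ($j=1,\dots,g$). Let the potentials $q_j\in L_2(0,l)$ be real-valued (possibly different on different edges), and consider on the edges the equations $$-y_j''+q_jy_j=\lambda y_j .$$ At every vertex other than $v_0$ impose the standard conditions: continuity together with Kirchhoff's condition $y_j'(l)=\sum_k y_k'(0)$, where $e_j$ is the incoming edge and the sum is over the outgoing edges (so $y_j'(l)=0$ if the vertex is pendant). The Neumann problem has the standard condition also at $v_0$ (continuity and $\sum_i y_i'(0)=0$ over the edges at $v_0$); the Dirichlet problem has $y_i(0)=0$ for all edges $e_i$ at $v_0$. Let $c_j(\lambda,x)$, $s_j(\lambda,x)$ be the solutions on $e_j$ with $c_j(\lambda,0)=1$, $c_j'(\lambda,0)=0$, $s_j(\lambda,0)=0$, $s_j'(\lambda,0)=1$, and write $y_j=A_jc_j+B_js_j$. Let $\phi_D(\lambda)$ and $\phi_N(\lambda)$ be the characteristic functions of the Dirichlet and the Neumann problem, that is, the determinants of the linear systems for the $A_j,B_j$ (for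 the Neumann problem also for the value $Y$ at the root) formed by the vertex conditions. For each edge $e_j$ there is the equation "$A_j$ minus the value at $x=l$ on the edge that ends where $e_j$ starts $=0$", which for $e_j$ starting at $v_0$ is $A_j=0$ (Dirichlet), respectively $A_j-Y=0$ (Neumann); for each edge $e_j$ there is the equation $y_j'(l)-\sum_k y_k'(0)=0$, the sum being over the edges outgoing from the end of $e_j$; and for the Neumann problem there is the further equation $-\sum_i B_i=0$ over the edges at $v_0$. The rows and columns are put in correspondence in the evident way ($A_j$ with the first equation of $e_j$, $B_j$ with the second one, $Y$ with the last one). Thus $\phi_N/\phi_D=-\sum_i y_i'(0)/y(v_0)$ for solutions that satisfy all vertex conditions except Kirchhoff's condition at $v_0$; for a single edge, $\phi_D=s'(\lambda,l)$ and $\phi_N=c'(\lambda,l)$. Let $$E(\tau)=\phi_N(\tau^2)+i\tau\,\phi_D(\tau^2),\qquad \tau=\sqrt\lambda\in\mathbb C,$$ be the Jost function of the problem in which a lead $[0,\infty)$ with zero potential is attached at $v_0$. Then $\phi_N$ and $E$ are entire functions and the following holds. 1. All zeros of $E(\tau)$ lie in the closed upper half-plane $\operatorname{Im}\tau\ge 0$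 or on a finite interval of the negative imaginary half-axis: there is $R>0$ such that every zero $\tau$ satisfies either $\operatorname{Im}\tau\ge 0$, or $\operatorname{Re}\tau=0$ and $-R<\operatorname{Im}\tau<0$. 2. The number of zeros of $E(\tau)$ on the open negative imaginary half-axis, counted with multiplicities, is finite and equals the (finite) number of negative zeros of $\phi_N(\lambda)$, counted with multiplicities. -/

import Mathlib

open MeasureTheory

/-- `y` is a solution of the Sturm-Liouville equation `-y'' + q y = lam y` on `[0, l]` with derivative
`dy`: both are continuous, `y' = dy`, and `dy` is absolutely continuous with `dy' = (q - lam) y`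
almost everywhere (integrated form). -/
structure IsSLSolution (q : ℝ → ℝ) (l : ℝ) (lam : ℂ) (y dy : ℝ → ℂ) : Prop where
  continuousOn : ContinuousOn y (Set.Icc 0 l)
  continuousOn_deriv : ContinuousOn dy (Set.Icc 0 l)
  eq_integral : ∀ x ∈ Set.Icc 0 l, y x = y 0 + ∫ t in (0 : ℝ)..x, dy t
  deriv_eq_integral : ∀ x ∈ Set.Icc 0 l,
    dy x = dy 0 + ∫ t in (0 : ℝ)..x, ((q t : ℂ) - lam) * y t

/-- The solution (together with its derivative) of `-y'' + q y = lam y` on `[0, l]` with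
`y(0) = a`, `y'(0) = b`. For `q ∈ L²(0, l)` it exists and is unique on `[0, l]`. -/
noncomputable def slSolution (q : ℝ → ℝ) (l : ℝ) (lam a b : ℂ) : (ℝ → ℂ) × (ℝ → ℂ) :=
  Classical.epsilon fun p : (ℝ → ℂ) × (ℝ → ℂ) =>
    IsSLSolution q l lam p.1 p.2 ∧ p.1 0 = a ∧ p.2 0 = b

/-- `c(lam, l)`, where `c(lam, 0) = 1` and `c'(lam, 0) = 0`. -/
noncomputable def slC (q : ℝ → ℝ) (l : ℝ) (lam : ℂ) : ℂ := (slSolution q l lam 1 0).1 l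

/-- `c'(lam, l)`. -/
noncomputable def slC' (q : ℝ → ℝ) (l : ℝ) (lam : ℂ) : ℂ := (slSolution q l lam 1 0).2 l

/-- `s(lam, l)`, where `s(lam, 0) = 0` and `s'(lam, 0) = 1`. -/
noncomputable def slS (q : ℝ → ℝ) (l : ℝ) (lam : ℂ) : ℂ := (slSolution q l lam 0 1).1 l

/-- `s'(lam, l)`. -/
noncomputable def slS' (q : ℝ → ℝ) (l : ℝ) (lam : ℂ) : ℂ := (slSolution q l lam 0 1).2 l

/-- In the tree `G` with root `r`, all edges directed away from `r`, there is an edge outgoing from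
`u` and incoming to `w`. -/
def IsChild {V : Type*} (G : SimpleGraph V) (r u w : V) : Prop :=
  G.Adj u w ∧ G.dist r w = G.dist r u + 1

open Classical in
/-- The `0`/`1` indicator of `IsChild`. -/
noncomputable def childInd {V : Type*} (G : SimpleGraph V) (r u w : V) : ℂ :=
  if IsChild G r u w then 1 else 0

/-- The linear system of the Dirichlet problem on the rooted tree.

Every vertex `w ≠ r` has exactly one incoming edge `e_w`, so the edges are indexed by the vertices
`w ≠ r`; `q w` is the potential on `e_w`, which is identified with `[0, l]` so that `l` is the end
`w`. On `e_w` we write `y_w = A_w c_w + B_w s_w`. The columns are the unknowns `A_w` (`Sum.inl w`)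
and `B_w` (`Sum.inr w`). The rows are
* `Sum.inl u`: `A_u - (A_w c_w(l) + B_w s_w(l)) = 0` if `e_u` starts at `w ≠ r` (continuity at `w`),
  and `A_u = 0` if `e_u` starts at `r` (Dirichlet condition at the root);
* `Sum.inr u`: `A_u c_u'(l) + B_u s_u'(l) - ∑ B_w = 0`, the sum being over the children `w` of `u`
  (Kirchhoff condition at `u`, which is the Neumann condition if `u` is pendant). -/
noncomputable def dirichletMatrix {V : Type*} [DecidableEq V] (G : SimpleGraph V) (r : V)
    (l : ℝ) (q : {v : V // v ≠ r} → ℝ → ℝ) (lam : ℂ) :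
    Matrix ({v : V // v ≠ r} ⊕ {v : V // v ≠ r}) ({v : V // v ≠ r} ⊕ {v : V // v ≠ r}) ℂ :=
  Matrix.fromBlocks
    (Matrix.of fun u w => (if u = w then 1 else 0) - childInd G r w u * slC (q w) l lam)
    (Matrix.of fun u w => -(childInd G r w u * slS (q w) l lam))
    (Matrix.of fun u w => if u = w then slC' (q u) l lam else 0)
    (Matrix.of fun u w => (if u = w then slS' (q u) l lam else 0) - childInd G r u w)

/-- The linear system of the Neumann problem on the rooted tree: there is one more unknown, the
value `Y` at the root, the rows `Sum.inl u` for `e_u` starting at `r` become `A_u - Y = 0`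
(continuity at the root), and there is one more row `-∑ B_w = 0`, the sum being over the children
`w` of `r` (Kirchhoff condition at the root, the Neumann condition if the root is pendant). -/
noncomputable def neumannMatrix {V : Type*} [DecidableEq V] (G : SimpleGraph V) (r : V)
    (l : ℝ) (q : {v : V // v ≠ r} → ℝ → ℝ) (lam : ℂ) :
    Matrix (Unit ⊕ ({v : V // v ≠ r} ⊕ {v : V // v ≠ r}))
      (Unit ⊕ ({v : V // v ≠ r} ⊕ {v : V // v ≠ r})) ℂ :=
  Matrix.fromBlocks
    0
    (Matrix.of fun _ => Sum.elim (fun _ => 0) (fun w : {v : V // v ≠ r} => -childInd G r r w))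
    (Matrix.of fun i _ => Sum.elim (fun u : {v : V // v ≠ r} => -childInd G r r u) (fun _ => 0) i)
    (dirichletMatrix G r l q lam)

/-- The characteristic function of the Dirichlet problem (Dirichlet condition at the root, standard
conditions at all other vertices). -/
noncomputable def phiD {V : Type*} [Fintype V] [DecidableEq V] (G : SimpleGraph V) (r : V)
    (l : ℝ) (q : {v : V // v ≠ r} → ℝ → ℝ) (lam : ℂ) : ℂ :=
  (dirichletMatrix G r l q lam).det

/-- The characteristic function of the Neumann problem (standard conditions at all vertices).
It is normalized by `phiN / phiD = -(∑ y_j'(0)) / y(r)` for solutions that satisfy all conditions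
except the Kirchhoff condition at the root `r`; thus `y_0(0) = phiD`, `y_0'(0) = phiN` are the Cauchy
data at the root of the solution on an attached lead directed away from the root. -/
noncomputable def phiN {V : Type*} [Fintype V] [DecidableEq V] (G : SimpleGraph V) (r : V)
    (l : ℝ) (q : {v : V // v ≠ r} → ℝ → ℝ) (lam : ℂ) : ℂ :=
  (neumannMatrix G r l q lam).det

/-- The Jost function `E`, as a function of `τ = √lam`. -/
noncomputable def jost {V : Type*} [Fintype V] [DecidableEq V] (G : SimpleGraph V) (r : V)
    (l : ℝ) (q : {v : V // v ≠ r} → ℝ → ℝ) (τ : ℂ) : ℂ :=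
  phiN G r l q (τ ^ 2) + Complex.I * τ * phiD G r l q (τ ^ 2)

/-- The zeros of `E` on the open negative imaginary half-axis. -/
def jostNegZeros {V : Type*} [Fintype V] [DecidableEq V] (G : SimpleGraph V) (r : V)
    (l : ℝ) (q : {v : V // v ≠ r} → ℝ → ℝ) : Set ℂ :=
  {τ : ℂ | τ.re = 0 ∧ τ.im < 0 ∧ jost G r l q τ = 0}

/-- The negative zeros of `phiN`. -/
def phiNNegZeros {V : Type*} [Fintype V] [DecidableEq V] (G : SimpleGraph V) (r : V)
    (l : ℝ) (q : {v : V // v ≠ r} → ℝ → ℝ) : Set ℂ :=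
  {lam : ℂ | lam.im = 0 ∧ lam.re < 0 ∧ phiN G r l q lam = 0}

/-! The eigenvalue problems enter only through the function `M = phiN / phiD`. Write `q̄` for the mean
of the potential `q` of an edge, `Q(x) = ∫₀ˣ (q - q̄)` and `u = y' - Q y`. Then `-y'' + q y = λ y` is
the system `y' = Q y + u`, `u' = (q̄ - Q² - λ) y - Q u` with continuous coefficients
(`isSLSolution_iff_regularized`), and `u = y'` at both ends of the edge, since `Q(0) = Q(l) = 0`.
A Neumann series makes its solutions entire in `λ` (`exists_linearODE_solution`), and

  `[y' ȳ]₀ˡ = ∫₀ˡ |u|² + (q̄ - Q² - λ) |y|²`   (`IsSLSolution.energy`).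

By the vertex conditions the left sides add up to the boundary term at the root alone
(`sum_flux_eq`), and this term is `M(λ)` for the solution with the value `1` at the root, by the
Schur complement of the bordered determinant. Hence (`phiD_ne_zero_and_energy`) off the real axis
`phiD ≠ 0` and `Im M` has the sign of `-Im λ`, and `M > 0` far to the left on the real axis. From
here on only this matters: `(phiN, phiD)` is an `IsAntiHerglotzPair`.

Location of the zeros: `E(τ) = 0` means `M(τ²) = -iτ`. For `Im τ < 0` and `Re τ ≠ 0` the imaginary
parts of both sides have opposite signs, and for `τ = -iκ` with large `κ > 0` the real parts do.

Number of the zeros: with `τ = -iκ`, `λ = -κ² < 0`, the zeros of `E` are those of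
`e = phiN + √(-λ) phiD`, with the same multiplicities. Both `M` and `M + √(-λ)` have an imaginary
part of sign opposite to that of `Im λ`; so on the negative half-axis they have negative derivatives
(`deriv_neg_of_im_mul_im_neg`), and they tend to `-∞` from the left and to `+∞` from the right at
their common poles. Common zeros of `phiN` and `phiD` contribute equally to the orders of `phiN` and
`e`; what is left are the zeros of `M` and of `M + √(-λ)`, all of them simple. Both are positive near
`-∞`, and `√(-λ)` vanishes at `0`, so in each interval between poles one of them has a zero if and
only if the other one has, and neither has more than one (`ncard_zeros_eq_ncard_zeros_add_sqrt`). -/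

/-! ### Linear differential equations with a parameter -/

namespace TreeJost

open Set

section LinearODE

variable {F : Type*} [NormedAddCommGroup F] [NormedSpace ℂ F]

/-- The operator `f ↦ ∫₀ˣ exp (-K (x - t)) f(t) dt` on `C([0, l], F)`. The weight makes its norm at
most `K⁻¹`, so that one Neumann series solves a linear differential equation on the whole interval.
-/
noncomputable def weightedPrimitive (l K : ℝ) (hl : 0 ≤ l) (hK : 0 < K) :
    C(Icc (0 : ℝ) l, F) →L[ℂ] C(Icc (0 : ℝ) l, F) :=
  LinearMap.mkContinuous
    { toFun := fun f =>
        { toFun := fun x => Real.exp (-K * x) •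
            ∫ t in (0 : ℝ)..x, Real.exp (K * t) • IccExtend hl f t
          continuous_toFun := by
            have h : Continuous fun t : ℝ => Real.exp (K * t) • IccExtend hl f t := by fun_prop
            have := intervalIntegral.continuous_primitive (μ := volume)
              (fun a b => h.intervalIntegrable a b) 0
            fun_prop }
      map_add' := by
        intro f g
        ext x
        have h : ∀ f : C(Icc (0 : ℝ) l, F),
            Continuous fun t : ℝ => Real.exp (K * t) • IccExtend hl f t := fun f => by fun_prop
        simp only [ContinuousMap.coe_mk, ContinuousMap.add_apply]
        rw [← smul_add, ← intervalIntegral.integral_add ((h f).intervalIntegrable _ _)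
          ((h g).intervalIntegrable _ _)]
        simp [IccExtend]
      map_smul' := by
        intro c f
        ext x
        simp only [ContinuousMap.coe_mk, ContinuousMap.smul_apply, RingHom.id_apply]
        rw [smul_comm c, ← intervalIntegral.integral_smul c]
        congr 1
        refine intervalIntegral.integral_congr fun t _ => ?_
        simp [IccExtend, smul_comm c] }
    K⁻¹ (by
      intro f
      refine (ContinuousMap.norm_le _ (by positivity)).2 fun x => ?_
      have hx := x.2
      have h1 : ‖∫ t in (0 : ℝ)..x, Real.exp (K * t) • IccExtend hl f t‖ ≤
          ∫ t in (0 : ℝ)..x, Real.exp (K * t) * ‖f‖ := by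
        refine intervalIntegral.norm_integral_le_of_norm_le hx.1 ?_ ?_
        · refine Filter.Eventually.of_forall fun t _ => ?_
          rw [norm_smul, Real.norm_eq_abs, Real.abs_exp]
          gcongr
          exact f.norm_coe_le_norm _
        · exact Continuous.intervalIntegrable (by fun_prop) _ _
      have h2 : ∫ t in (0 : ℝ)..x, Real.exp (K * t) * ‖f‖ =
          (Real.exp (K * x) - 1) * K⁻¹ * ‖f‖ := by
        rw [intervalIntegral.integral_mul_const, intervalIntegral.integral_comp_mul_left _ hK.ne']
        simp [mul_comm]
      simp only [LinearMap.coe_mk, AddHom.coe_mk, ContinuousMap.coe_mk]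
      rw [norm_smul, Real.norm_eq_abs, Real.abs_exp]
      refine (mul_le_mul_of_nonneg_left (h1.trans h2.le) (Real.exp_pos _).le).trans ?_
      have h3 : Real.exp (-K * x) * Real.exp (K * x) = 1 := by
        rw [← Real.exp_add]; simp
      have h4 : Real.exp (-K * x) * ((Real.exp (K * x) - 1) * K⁻¹ * ‖f‖) =
          (1 - Real.exp (-K * x)) * (K⁻¹ * ‖f‖) := by linear_combination K⁻¹ * ‖f‖ * h3
      rw [h4]
      have : 0 ≤ K⁻¹ * ‖f‖ := by positivity
      nlinarith [Real.exp_pos (-K * x)])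

lemma norm_weightedPrimitive_le {l K : ℝ} (hl : 0 ≤ l) (hK : 0 < K) :
    ‖(weightedPrimitive l K hl hK : C(Icc (0 : ℝ) l, F) →L[ℂ] C(Icc (0 : ℝ) l, F))‖ ≤ K⁻¹ :=
  LinearMap.mkContinuous_norm_le _ (by positivity) _

/-- The operator on `C(X, F)` that applies a continuous family of operators on `F` pointwise. -/
noncomputable def pointwiseApply {X : Type*} [TopologicalSpace X] [CompactSpace X]
    (A : C(X, F →L[ℂ] F)) : C(X, F) →L[ℂ] C(X, F) :=
  LinearMap.mkContinuous
    { toFun := fun f => ⟨fun x => A x (f x), by fun_prop⟩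
      map_add' := by intro f g; ext x; simp
      map_smul' := by intro c f; ext x; simp }
    ‖A‖ (by
      intro f
      refine (ContinuousMap.norm_le _ (by positivity)).2 fun x => ?_
      exact ((A x).le_opNorm (f x)).trans
        (by gcongr; exacts [A.norm_coe_le_norm x, f.norm_coe_le_norm x]))

@[simp] lemma pointwiseApply_apply {X : Type*} [TopologicalSpace X] [CompactSpace X]
    (A : C(X, F →L[ℂ] F)) (f : C(X, F)) (x : X) : pointwiseApply A f x = A x (f x) := rfl

/-- Near `z₀` the equation `f = f₀ + J (M + z N) f` is solved by a Neumann series, with a solution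
that depends differentiably on `z`. -/
lemma exists_resolvent_family {E : Type*} [NormedAddCommGroup E] [NormedSpace ℂ E]
    [CompleteSpace E] (J M N : E →L[ℂ] E) (f₀ : E) (z₀ : ℂ)
    (h : ‖J‖ * (‖M‖ + (‖z₀‖ + 1) * ‖N‖) < 1) :
    ∃ f : ℂ → E, (∀ᶠ z in nhds z₀, f z = f₀ + J (M (f z) + z • N (f z))) ∧
      DifferentiableAt ℂ f z₀ := by
  set T : ℂ → (E →L[ℂ] E) := fun z => J * M + z • (J * N) with hT
  have hTdiff : Differentiable ℂ T := by
    simp only [hT]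
    fun_prop
  have hunit : ∀ z, ‖z‖ < ‖z₀‖ + 1 → IsUnit (1 - T z) := by
    intro z hz
    refine isUnit_one_sub_of_norm_lt_one (lt_of_le_of_lt ?_ h)
    refine (norm_add_le _ _).trans ?_
    rw [norm_smul, mul_add]
    refine add_le_add (norm_mul_le _ _) ?_
    calc ‖z‖ * ‖J * N‖ ≤ (‖z₀‖ + 1) * (‖J‖ * ‖N‖) := by
          gcongr
          exact norm_mul_le _ _
      _ = _ := by ring
  refine ⟨fun z => Ring.inverse (1 - T z) f₀, ?_, ?_⟩
  · have hev : ∀ᶠ z in nhds z₀, ‖z‖ < ‖z₀‖ + 1 :=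
      continuous_norm.continuousAt.eventually_lt continuousAt_const (by simp)
    filter_upwards [hev] with z hz
    have h1 : (1 - T z) (Ring.inverse (1 - T z) f₀) = f₀ :=
      DFunLike.congr_fun (Ring.mul_inverse_cancel _ (hunit z hz)) f₀
    conv_rhs => lhs; rw [← h1]
    simp [hT]
  · have h1 : DifferentiableAt ℂ (Ring.inverse ∘ fun z => (1 - T z)) z₀ :=
      (differentiableAt_inverse (𝕜 := ℂ) (hunit z₀ (by simp))).comp z₀
        ((differentiableAt_const _).fun_sub hTdiff.differentiableAt)
    exact h1.clm_apply (differentiableAt_const _)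

/-- Solutions of the initial value problem `Y' = (A + z B) Y`, `Y(0) = v`, in integrated form, near the
parameter `z₀`. The substitution `Y = exp (K x) f` brings it into the form of
`exists_resolvent_family`. -/
theorem exists_linearODE_solution [CompleteSpace F] {l : ℝ} (hl : 0 ≤ l) {A B : ℝ → F →L[ℂ] F}
    (hA : ContinuousOn A (Icc 0 l)) (hB : ContinuousOn B (Icc 0 l)) (v : F) (z₀ : ℂ) :
    ∃ Y : ℂ → ℝ → F,
      (∀ᶠ z in nhds z₀, ContinuousOn (Y z) (Icc 0 l) ∧
        ∀ x ∈ Icc 0 l, Y z x = v + ∫ t in (0 : ℝ)..x, (A t + z • B t) (Y z t)) ∧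
      ∀ x ∈ Icc 0 l, DifferentiableAt ℂ (fun z => Y z x) z₀ := by
  set A' : C(Icc (0 : ℝ) l, F →L[ℂ] F) := ⟨fun x => A x, hA.domRestrict⟩ with hA'
  set B' : C(Icc (0 : ℝ) l, F →L[ℂ] F) := ⟨fun x => B x, hB.domRestrict⟩ with hB'
  set K : ℝ := ‖pointwiseApply A'‖ + (‖z₀‖ + 1) * ‖pointwiseApply B'‖ + 1 with hKdef
  have hK : 0 < K := by positivity
  set f₀ : C(Icc (0 : ℝ) l, F) := ⟨fun x => Real.exp (-K * x) • v, by fun_prop⟩ with hf₀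
  obtain ⟨f, hf, hd⟩ := exists_resolvent_family (weightedPrimitive l K hl hK) (pointwiseApply A')
    (pointwiseApply B') f₀ z₀ (by
      refine lt_of_le_of_lt (mul_le_mul_of_nonneg_right (norm_weightedPrimitive_le hl hK)
        (by positivity)) ?_
      rw [inv_mul_lt_iff₀ hK]
      linarith)
  have hexp : ∀ x : ℝ, Real.exp (K * x) * Real.exp (-K * x) = 1 := fun x => by
    rw [← Real.exp_add]; simp
  refine ⟨fun z x => Real.exp (K * x) • IccExtend hl (f z) x, ?_, ?_⟩
  · filter_upwards [hf] with z hz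
    refine ⟨by fun_prop, fun x hx => ?_⟩
    have h3 : f z ⟨x, hx⟩ = Real.exp (-K * x) • v + Real.exp (-K * x) • ∫ t in (0 : ℝ)..x,
        Real.exp (K * t) •
          IccExtend hl (pointwiseApply A' (f z) + z • pointwiseApply B' (f z)) t := by
      conv_lhs => rw [hz]
      rfl
    rw [IccExtend_of_mem hl _ hx, h3, ← smul_add, smul_smul, hexp, one_smul]
    congr 1
    refine intervalIntegral.integral_congr fun t ht => ?_
    rw [uIcc_of_le hx.1] at ht
    have ht' : t ∈ Icc 0 l := ⟨ht.1, ht.2.trans hx.2⟩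
    simp only [IccExtend_of_mem hl _ ht']
    simp only [← Complex.coe_smul, map_smul]
    simp [A', B']
    rfl
  · intro x hx
    let ev : C(Icc (0 : ℝ) l, F) →L[ℂ] F := ContinuousMap.evalCLM ℂ (⟨x, hx⟩ : Icc (0 : ℝ) l)
    have he : DifferentiableAt ℂ (fun z => f z ⟨x, hx⟩) z₀ :=
      ev.differentiableAt.comp z₀ hd
    simp only [IccExtend_of_mem hl _ hx]
    exact he.const_smul _

lemma hasDerivWithinAt_primitive [CompleteSpace F] {l : ℝ} {g : ℝ → F}
    (hg : ContinuousOn g (Icc 0 l)) {x : ℝ} (hx : x ∈ Icc 0 l) :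
    HasDerivWithinAt (fun u => ∫ t in (0 : ℝ)..u, g t) (g x) (Icc 0 l) x := by
  have : Fact (x ∈ Icc 0 l) := ⟨hx⟩
  exact intervalIntegral.integral_hasDerivWithinAt_right
    (hg.mono (by rw [uIcc_of_le hx.1]; exact Icc_subset_Icc_right hx.2)).intervalIntegrable
    (hg.stronglyMeasurableAtFilter_nhdsWithin measurableSet_Icc x) (hg x hx)

theorem eq_zero_of_eq_integral_linear [CompleteSpace F] {l : ℝ} {A : ℝ → F →L[ℂ] F}
    (hA : ContinuousOn A (Icc 0 l)) {Y : ℝ → F} (hY : ContinuousOn Y (Icc 0 l))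
    (h : ∀ x ∈ Icc 0 l, Y x = ∫ t in (0 : ℝ)..x, A t (Y t)) :
    ∀ x ∈ Icc 0 l, Y x = 0 := by
  rcases lt_or_ge l 0 with hl | hl
  · intro x hx
    exact absurd (hx.1.trans hx.2) (not_le.2 hl)
  obtain ⟨K, hK⟩ := isCompact_Icc.exists_bound_of_continuousOn hA
  have hAY : ContinuousOn (fun t => A t (Y t)) (Icc 0 l) := hA.clm_apply hY
  refine eq_zero_of_abs_deriv_le_mul_abs_self_of_eq_zero_right (f' := fun t => A t (Y t)) (K := K)
    hY ?_ (by simpa using h 0 ⟨le_rfl, hl⟩) ?_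
  · intro x hx
    have hx' : x ∈ Icc 0 l := Ico_subset_Icc_self hx
    have h1 := (hasDerivWithinAt_primitive hAY hx').congr (f₁ := Y) h (h x hx')
    exact h1.mono_of_mem_nhdsWithin
      (mem_nhdsWithin.2 ⟨Iio l, isOpen_Iio, hx.2, fun t ht => ⟨hx.1.trans ht.2, ht.1.le⟩⟩)
  · intro x hx
    exact (A x).le_of_opNorm_le (hK x (Ico_subset_Icc_self hx)) _

end LinearODE

/-- The product rule for two primitives of integrable functions. -/
lemma integral_mul_primitive_add_real {p r : ℝ → ℝ} {x : ℝ}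
    (hp : IntervalIntegrable p volume 0 x) (hr : IntervalIntegrable r volume 0 x) :
    ∫ t in (0 : ℝ)..x, (p t * (∫ s in (0 : ℝ)..t, r s) + (∫ s in (0 : ℝ)..t, p s) * r t) =
      (∫ t in (0 : ℝ)..x, p t) * ∫ t in (0 : ℝ)..x, r t := by
  have hP := hp.absolutelyContinuousOnInterval_intervalIntegral (c := 0) (by simp)
  have hR := hr.absolutelyContinuousOnInterval_intervalIntegral (c := 0) (by simp)
  have h := AbsolutelyContinuousOnInterval.integral_deriv_mul_eq_sub hP hR
  simp only [intervalIntegral.integral_same, mul_zero, sub_zero] at h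
  rw [← h]
  refine intervalIntegral.integral_congr_ae ?_
  filter_upwards [hp.ae_hasDerivAt_integral, hr.ae_hasDerivAt_integral] with t h1 h2 ht
  have ht' := uIoc_subset_uIcc ht
  rw [(h1 ht' 0 (by simp)).deriv, (h2 ht' 0 (by simp)).deriv]

lemma integral_mul_primitive_add {p : ℝ → ℝ} {r : ℝ → ℂ} {x : ℝ}
    (hp : IntervalIntegrable p volume 0 x) (hr : IntervalIntegrable r volume 0 x) :
    ∫ t in (0 : ℝ)..x,
        ((p t : ℂ) * (∫ s in (0 : ℝ)..t, r s) + ((∫ s in (0 : ℝ)..t, p s : ℝ) : ℂ) * r t) =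
      ((∫ t in (0 : ℝ)..x, p t : ℝ) : ℂ) * ∫ t in (0 : ℝ)..x, r t := by
  have hre : IntervalIntegrable (fun t => (r t).re) volume 0 x := ⟨hr.1.re, hr.2.re⟩
  have him : IntervalIntegrable (fun t => (r t).im) volume 0 x := ⟨hr.1.im, hr.2.im⟩
  have hsub : ∀ t ∈ uIcc 0 x, IntervalIntegrable r volume 0 t := fun t ht =>
    hr.mono_set (uIcc_subset_uIcc_left ht)
  have hRre : ∀ t ∈ uIcc 0 x, (∫ s in (0 : ℝ)..t, r s).re = ∫ s in (0 : ℝ)..t, (r s).re :=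
    fun t ht => (Complex.reCLM.intervalIntegral_comp_comm (hsub t ht)).symm
  have hRim : ∀ t ∈ uIcc 0 x, (∫ s in (0 : ℝ)..t, r s).im = ∫ s in (0 : ℝ)..t, (r s).im :=
    fun t ht => (Complex.imCLM.intervalIntegral_comp_comm (hsub t ht)).symm
  have hPc : ContinuousOn (fun t => ∫ s in (0 : ℝ)..t, p s) (uIcc 0 x) :=
    intervalIntegral.continuousOn_primitive_interval' hp (by simp)
  have hRc : ContinuousOn (fun t => ∫ s in (0 : ℝ)..t, r s) (uIcc 0 x) :=
    intervalIntegral.continuousOn_primitive_interval' hr (by simp)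
  have hp' : IntervalIntegrable (fun t => (p t : ℂ)) volume 0 x := ⟨hp.1.ofReal, hp.2.ofReal⟩
  have hint : IntervalIntegrable (fun t => (p t : ℂ) * (∫ s in (0 : ℝ)..t, r s) +
      ((∫ s in (0 : ℝ)..t, p s : ℝ) : ℂ) * r t) volume 0 x :=
    (hp'.mul_continuousOn hRc).add 
      (hr.continuousOn_mul (Complex.continuous_ofReal.comp_continuousOn hPc))
  apply Complex.ext
  · have h := Complex.reCLM.intervalIntegral_comp_comm hint
    simp only [Complex.reCLM_apply] at h
    rw [← h, Complex.re_ofReal_mul, hRre x (by simp), ← integral_mul_primitive_add_real hp hre]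
    refine intervalIntegral.integral_congr fun t ht => ?_
    simp only [Complex.add_re, Complex.re_ofReal_mul, hRre t ht]
  · have h := Complex.imCLM.intervalIntegral_comp_comm hint
    simp only [Complex.imCLM_apply] at h
    rw [← h, Complex.im_ofReal_mul, hRim x (by simp), ← integral_mul_primitive_add_real hp him]
    refine intervalIntegral.integral_congr fun t ht => ?_
    simp only [Complex.add_im, Complex.im_ofReal_mul, hRim t ht]
end TreeJost

/-! ### The Sturm-Liouville equation on one edge -/

namespace TreeJost

open Set

/-- The mean value of `q` on `[0, l]`. -/
noncomputable def meanValue (q : ℝ → ℝ) (l : ℝ) : ℝ := l⁻¹ * ∫ t in (0 : ℝ)..l, q t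

/-- The primitive of `q` minus its mean value; it vanishes at both `0` and `l`. -/
noncomputable def centeredPrimitive (q : ℝ → ℝ) (l x : ℝ) : ℝ :=
  ∫ t in (0 : ℝ)..x, (q t - meanValue q l)

section Edge

variable {q : ℝ → ℝ} {l : ℝ}

@[simp] lemma centeredPrimitive_zero : centeredPrimitive q l 0 = 0 := by
  simp [centeredPrimitive]

lemma intervalIntegrable_sub_meanValue (hq : IntervalIntegrable q volume 0 l) :
    IntervalIntegrable (fun t => q t - meanValue q l) volume 0 l :=
  hq.sub intervalIntegrable_const

lemma centeredPrimitive_self (hl : 0 < l) (hq : IntervalIntegrable q volume 0 l) :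
    centeredPrimitive q l l = 0 := by
  rw [centeredPrimitive, intervalIntegral.integral_sub hq intervalIntegrable_const]
  simp [meanValue, hl.ne']

lemma continuousOn_centeredPrimitive (hl : 0 ≤ l) (hq : IntervalIntegrable q volume 0 l) :
    ContinuousOn (centeredPrimitive q l) (Icc 0 l) := by
  have := intervalIntegral.continuousOn_primitive_interval' (intervalIntegrable_sub_meanValue hq)
    (left_mem_uIcc)
  rwa [uIcc_of_le hl] at this

lemma _root_.ContinuousOn.intervalIntegrable_of_mem_Icc {g : ℝ → ℂ}
    (hg : ContinuousOn g (Icc 0 l)) {x : ℝ} (hx : x ∈ Icc 0 l) :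
    IntervalIntegrable g volume 0 x :=
  (hg.mono (by rw [uIcc_of_le hx.1]; exact Icc_subset_Icc_right hx.2)).intervalIntegrable

lemma intervalIntegrable_potential_mul (hq : IntervalIntegrable q volume 0 l) (lam : ℂ) {g : ℝ → ℂ}
    (hg : ContinuousOn g (Icc 0 l)) {x : ℝ} (hx : x ∈ Icc 0 l) :
    IntervalIntegrable (fun t => ((q t : ℂ) - lam) * g t) volume 0 x := by
  have h1 : IntervalIntegrable q volume 0 x :=
    hq.mono_set (by rw [uIcc_of_le hx.1, uIcc_of_le (hx.1.trans hx.2)]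
                    exact Icc_subset_Icc_right hx.2)
  have h2 : IntervalIntegrable (fun t => (q t : ℂ)) volume 0 x := ⟨h1.1.ofReal, h1.2.ofReal⟩
  exact (h2.sub intervalIntegrable_const).mul_continuousOn
    (hg.mono (by rw [uIcc_of_le hx.1]; exact Icc_subset_Icc_right hx.2))

/-- In terms of the quasi-derivative `u = y' - Q y`, where `Q` is `centeredPrimitive q l`, the
Sturm-Liouville equation is a first order system whose coefficients are continuous, although `q` is
only integrable. -/
lemma isSLSolution_iff_regularized (hl : 0 ≤ l) (hq : IntervalIntegrable q volume 0 l) {lam : ℂ}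
    {y u : ℝ → ℂ} (hy : ContinuousOn y (Icc 0 l)) (hu : ContinuousOn u (Icc 0 l)) :
    IsSLSolution q l lam y (fun x => u x + centeredPrimitive q l x * y x) ↔
      (∀ x ∈ Icc 0 l, y x = y 0 + ∫ t in (0 : ℝ)..x, (u t + centeredPrimitive q l t * y t)) ∧
      ∀ x ∈ Icc 0 l, u x = u 0 + ∫ t in (0 : ℝ)..x,
        ((meanValue q l - (centeredPrimitive q l t : ℂ) ^ 2 - lam) * y t -
          centeredPrimitive q l t * u t) := by
  set Q := centeredPrimitive q l with hQ
  set m := meanValue q l with hm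
  have hQc : ContinuousOn (fun x => (Q x : ℂ)) (Icc 0 l) :=
    Complex.continuous_ofReal.comp_continuousOn (continuousOn_centeredPrimitive hl hq)
  have hdy : ContinuousOn (fun x => u x + Q x * y x) (Icc 0 l) := hu.add (hQc.mul hy)
  have hv : ContinuousOn (fun t => (m - (Q t : ℂ) ^ 2 - lam) * y t - Q t * u t) (Icc 0 l) :=
    (((continuousOn_const.sub (hQc.pow 2)).sub continuousOn_const).mul hy).sub (hQc.mul hu)
  -- the product rule `(Q y)' = (q - m) y + Q y'`, with the terms sorted as the system needs them
  have key : (∀ x ∈ Icc 0 l, y x = y 0 + ∫ t in (0 : ℝ)..x, (u t + Q t * y t)) →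
      ∀ x ∈ Icc 0 l, Q x * y x = (∫ t in (0 : ℝ)..x, ((q t : ℂ) - lam) * y t) -
        ∫ t in (0 : ℝ)..x, ((m - (Q t : ℂ) ^ 2 - lam) * y t - Q t * u t) := by
    intro h x hx
    have hsub : uIcc 0 x ⊆ Icc 0 l := by
      rw [uIcc_of_le hx.1]; exact Icc_subset_Icc_right hx.2
    have hp : IntervalIntegrable (fun t => q t - m) volume 0 x :=
      (intervalIntegrable_sub_meanValue hq).mono_set (by rwa [uIcc_of_le hl])
    have hp' : IntervalIntegrable (fun t => ((q t - m : ℝ) : ℂ)) volume 0 x :=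
      ⟨hp.1.ofReal, hp.2.ofReal⟩
    have h1 := integral_mul_primitive_add hp (hdy.intervalIntegrable_of_mem_Icc hx)
    have hR : ContinuousOn (fun t => ∫ s in (0 : ℝ)..t, (u s + Q s * y s)) (uIcc 0 x) :=
      intervalIntegral.continuousOn_primitive_interval' (hdy.intervalIntegrable_of_mem_Icc hx)
        left_mem_uIcc
    have h2 : (Q x : ℂ) * y 0 = ∫ t in (0 : ℝ)..x, ((q t - m : ℝ) : ℂ) * y 0 := by
      rw [intervalIntegral.integral_mul_const, intervalIntegral.integral_ofReal]
      rfl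
    rw [h x hx, mul_add, h2, ← intervalIntegral.integral_sub
      (intervalIntegrable_potential_mul hq lam hy hx) (hv.intervalIntegrable_of_mem_Icc hx)]
    refine (congrArg _ h1.symm).trans ?_
    rw [← intervalIntegral.integral_add (hp'.mul_const _)]
    · refine intervalIntegral.integral_congr fun t ht => ?_
      have h3 := h t (hsub ht)
      have h4 : ∫ s in (0 : ℝ)..t, (u s + Q s * y s) = y t - y 0 := by rw [h3]; ring
      have h5 : (∫ s in (0 : ℝ)..t, (q s - m)) = Q t := rfl
      simp only [h4, h5]
      push_cast
      ring
    · exact (hp'.mul_continuousOn hR).add ((hdy.intervalIntegrable_of_mem_Icc hx).continuousOn_mul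
        (hQc.mono hsub))
  constructor
  · intro h
    have h1 := h.eq_integral
    refine ⟨h1, fun x hx => ?_⟩
    have h2 := h.deriv_eq_integral x hx
    simp only [hQ, centeredPrimitive_zero] at h2
    rw [← hQ, key h1 x hx] at h2
    push_cast at h2
    linear_combination h2
  · rintro ⟨h1, h2⟩
    refine ⟨hy, hdy, h1, fun x hx => ?_⟩
    have h3 : Q 0 = 0 := centeredPrimitive_zero
    rw [h2 x hx, key h1 x hx, h3]
    push_cast
    ring

lemma _root_.IsSLSolution.linear_combination (hq : IntervalIntegrable q volume 0 l) {lam : ℂ}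
    {y dy z dz : ℝ → ℂ} (hy : IsSLSolution q l lam y dy) (hz : IsSLSolution q l lam z dz)
    (a b : ℂ) :
    IsSLSolution q l lam (fun x => a * y x + b * z x) (fun x => a * dy x + b * dz x) where
  continuousOn := (continuousOn_const.mul hy.continuousOn).add
    (continuousOn_const.mul hz.continuousOn)
  continuousOn_deriv := (continuousOn_const.mul hy.continuousOn_deriv).add
    (continuousOn_const.mul hz.continuousOn_deriv)
  eq_integral x hx := by
    rw [intervalIntegral.integral_add
      ((hy.continuousOn_deriv.intervalIntegrable_of_mem_Icc hx).const_mul _)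
      ((hz.continuousOn_deriv.intervalIntegrable_of_mem_Icc hx).const_mul _),
      intervalIntegral.integral_const_mul, intervalIntegral.integral_const_mul]
    linear_combination a * hy.eq_integral x hx + b * hz.eq_integral x hx
  deriv_eq_integral x hx := by
    have h : ∀ t, ((q t : ℂ) - lam) * (a * y t + b * z t) =
      a * (((q t : ℂ) - lam) * y t) + b * (((q t : ℂ) - lam) * z t) := fun t => by ring
    simp only [h]
    rw [intervalIntegral.integral_add
      ((intervalIntegrable_potential_mul hq lam hy.continuousOn hx).const_mul _)
      ((intervalIntegrable_potential_mul hq lam hz.continuousOn hx).const_mul _),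
      intervalIntegral.integral_const_mul, intervalIntegral.integral_const_mul]
    linear_combination a * hy.deriv_eq_integral x hx + b * hz.deriv_eq_integral x hx

/-- The part independent of `lam` of the coefficient matrix of the system for `(y, y' - Q y)`. -/
noncomputable def regularCoeff (q : ℝ → ℝ) (l t : ℝ) : ℂ × ℂ →L[ℂ] ℂ × ℂ :=
  (centeredPrimitive q l t : ℂ) •
      (ContinuousLinearMap.fst ℂ ℂ ℂ).prod (-ContinuousLinearMap.snd ℂ ℂ ℂ) +
    (centeredPrimitive q l t : ℂ) ^ 2 •
      (0 : ℂ × ℂ →L[ℂ] ℂ).prod (-ContinuousLinearMap.fst ℂ ℂ ℂ) +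
    (ContinuousLinearMap.snd ℂ ℂ ℂ).prod ((meanValue q l : ℂ) • ContinuousLinearMap.fst ℂ ℂ ℂ)

/-- The factor of `lam` in the coefficient matrix of the system for `(y, y' - Q y)`. -/
noncomputable def spectralCoeff : ℂ × ℂ →L[ℂ] ℂ × ℂ :=
  (0 : ℂ × ℂ →L[ℂ] ℂ).prod (-ContinuousLinearMap.fst ℂ ℂ ℂ)

lemma regularCoeff_add_apply (t : ℝ) (lam : ℂ) (p : ℂ × ℂ) :
    (regularCoeff q l t + lam • spectralCoeff) p =
      (p.2 + centeredPrimitive q l t * p.1,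
        (meanValue q l - (centeredPrimitive q l t : ℂ) ^ 2 - lam) * p.1 -
          centeredPrimitive q l t * p.2) := by
  refine Prod.ext ?_ ?_ <;> simp [regularCoeff, spectralCoeff] <;> ring

lemma continuousOn_regularCoeff (hl : 0 ≤ l) (hq : IntervalIntegrable q volume 0 l) :
    ContinuousOn (regularCoeff q l) (Icc 0 l) := by
  have hQc : ContinuousOn (fun x => (centeredPrimitive q l x : ℂ)) (Icc 0 l) :=
    Complex.continuous_ofReal.comp_continuousOn (continuousOn_centeredPrimitive hl hq)
  exact ((hQc.smul continuousOn_const).add ((hQc.pow 2).smul continuousOn_const)).add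
    continuousOn_const

lemma isSLSolution_iff_linearODE (hl : 0 ≤ l) (hq : IntervalIntegrable q volume 0 l) {lam : ℂ}
    {Y : ℝ → ℂ × ℂ} (hY : ContinuousOn Y (Icc 0 l)) :
    IsSLSolution q l lam (fun x => (Y x).1)
        (fun x => (Y x).2 + centeredPrimitive q l x * (Y x).1) ↔
      ∀ x ∈ Icc 0 l, Y x = Y 0 + ∫ t in (0 : ℝ)..x,
        (regularCoeff q l t + lam • spectralCoeff) (Y t) := by
  rw [isSLSolution_iff_regularized hl hq (u := fun x => (Y x).2) hY.fst hY.snd, ← forall₂_and]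
  refine forall₂_congr fun x hx => ?_
  have hc : ContinuousOn (fun t => (regularCoeff q l t + lam • spectralCoeff) (Y t)) (Icc 0 l) :=
    ((continuousOn_regularCoeff hl hq).add continuousOn_const).clm_apply hY
  have hi : IntervalIntegrable (fun t => (regularCoeff q l t + lam • spectralCoeff) (Y t))
      volume 0 x :=
    (hc.mono (by rw [uIcc_of_le hx.1]; exact Icc_subset_Icc_right hx.2)).intervalIntegrable
  have h1 := (ContinuousLinearMap.fst ℂ ℂ ℂ).intervalIntegral_comp_comm hi
  have h2 := (ContinuousLinearMap.snd ℂ ℂ ℂ).intervalIntegral_comp_comm hi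
  simp only [ContinuousLinearMap.coe_fst', ContinuousLinearMap.coe_snd'] at h1 h2
  rw [Prod.ext_iff, Prod.fst_add, Prod.snd_add, ← h1, ← h2]
  simp only [regularCoeff_add_apply]

lemma exists_isSLSolution_family (hl : 0 < l) (hq : IntervalIntegrable q volume 0 l) (a b z₀ : ℂ) :
    ∃ y dy : ℂ → ℝ → ℂ,
      (∀ᶠ z in nhds z₀, IsSLSolution q l z (y z) (dy z) ∧ y z 0 = a ∧ dy z 0 = b) ∧
      DifferentiableAt ℂ (fun z => y z l) z₀ ∧ DifferentiableAt ℂ (fun z => dy z l) z₀ := by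
  obtain ⟨Y, hY, hd⟩ := exists_linearODE_solution hl.le (continuousOn_regularCoeff hl.le hq)
    (continuousOn_const (c := spectralCoeff)) (a, b) z₀
  refine ⟨fun z x => (Y z x).1, fun z x => (Y z x).2 + centeredPrimitive q l x * (Y z x).1,
    ?_, ?_, ?_⟩
  · filter_upwards [hY] with z hz
    have h0 : Y z 0 = (a, b) := by simpa using hz.2 0 ⟨le_rfl, hl.le⟩
    refine ⟨(isSLSolution_iff_linearODE hl.le hq hz.1).2 fun x hx => ?_, ?_, ?_⟩
    · rw [h0]
      exact hz.2 x hx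
    · simp [h0]
    · simp [h0]
  · exact (hd l ⟨hl.le, le_rfl⟩).fst
  · simp only [centeredPrimitive_self hl hq, Complex.ofReal_zero, zero_mul, add_zero]
    exact (hd l ⟨hl.le, le_rfl⟩).snd

lemma _root_.IsSLSolution.eq_zero (hl : 0 < l) (hq : IntervalIntegrable q volume 0 l) {lam : ℂ}
    {y dy : ℝ → ℂ} (h : IsSLSolution q l lam y dy) (h0 : y 0 = 0) (h1 : dy 0 = 0) :
    ∀ x ∈ Icc 0 l, y x = 0 ∧ dy x = 0 := by
  have hQc : ContinuousOn (fun x => (centeredPrimitive q l x : ℂ)) (Icc 0 l) :=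
    Complex.continuous_ofReal.comp_continuousOn (continuousOn_centeredPrimitive hl.le hq)
  set Y : ℝ → ℂ × ℂ := fun x => (y x, dy x - centeredPrimitive q l x * y x) with hYdef
  have hY : ContinuousOn Y (Icc 0 l) :=
    h.continuousOn.prodMk (h.continuousOn_deriv.sub (hQc.mul h.continuousOn))
  have h2 := (isSLSolution_iff_linearODE (lam := lam) hl.le hq hY).1 (by simpa [hYdef] using h)
  have hY0 : Y 0 = 0 := by simp [hYdef, h0, h1]
  have h3 := eq_zero_of_eq_integral_linear
    ((continuousOn_regularCoeff hl.le hq).add (continuousOn_const (c := lam • spectralCoeff))) hY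
    (fun x hx => by simpa [hY0] using h2 x hx)
  intro x hx
  have h4 := h3 x hx
  simp only [hYdef, Prod.mk_eq_zero] at h4
  refine ⟨h4.1, ?_⟩
  simpa [h4.1] using h4.2

lemma _root_.IsSLSolution.unique (hl : 0 < l) (hq : IntervalIntegrable q volume 0 l) {lam : ℂ}
    {y dy z dz : ℝ → ℂ} (hy : IsSLSolution q l lam y dy) (hz : IsSLSolution q l lam z dz)
    (h0 : y 0 = z 0) (h1 : dy 0 = dz 0) : y l = z l ∧ dy l = dz l := by
  have h := (hy.linear_combination hq hz 1 (-1)).eq_zero hl hq (by simp [h0]) (by simp [h1]) l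
    ⟨hl.le, le_rfl⟩
  constructor
  · linear_combination h.1
  · linear_combination h.2

lemma slSolution_spec (hl : 0 < l) (hq : IntervalIntegrable q volume 0 l) (lam a b : ℂ) :
    IsSLSolution q l lam (slSolution q l lam a b).1 (slSolution q l lam a b).2 ∧
      (slSolution q l lam a b).1 0 = a ∧ (slSolution q l lam a b).2 0 = b := by
  obtain ⟨y, dy, h, -⟩ := exists_isSLSolution_family hl hq a b lam
  exact Classical.epsilon_spec (p := fun p : (ℝ → ℂ) × (ℝ → ℂ) =>
    IsSLSolution q l lam p.1 p.2 ∧ p.1 0 = a ∧ p.2 0 = b) ⟨(y lam, dy lam), h.self_of_nhds⟩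

lemma differentiable_slSolution (hl : 0 < l) (hq : IntervalIntegrable q volume 0 l) (a b : ℂ) :
    Differentiable ℂ (fun lam => (slSolution q l lam a b).1 l) ∧
      Differentiable ℂ (fun lam => (slSolution q l lam a b).2 l) := by
  have key : ∀ z₀, DifferentiableAt ℂ (fun lam => (slSolution q l lam a b).1 l) z₀ ∧
      DifferentiableAt ℂ (fun lam => (slSolution q l lam a b).2 l) z₀ := by
    intro z₀
    obtain ⟨y, dy, h, h1, h2⟩ := exists_isSLSolution_family hl hq a b z₀
    have h3 : ∀ᶠ z in nhds z₀, (slSolution q l z a b).1 l = y z l ∧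
        (slSolution q l z a b).2 l = dy z l := by
      filter_upwards [h] with z hz
      have hs := slSolution_spec hl hq z a b
      exact hs.1.unique hl hq hz.1 (hs.2.1.trans hz.2.1.symm) (hs.2.2.trans hz.2.2.symm)
    exact ⟨h1.congr_of_eventuallyEq (h3.mono fun _ hz => hz.1),
      h2.congr_of_eventuallyEq (h3.mono fun _ hz => hz.2)⟩
  exact ⟨fun z => (key z).1, fun z => (key z).2⟩

/-- The energy identity: the derivative of `u ȳ`, where `u = y' - Q y`, is
`|u|² + (m - Q² - lam) |y|²`, and `u = y'` at both ends. -/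
lemma _root_.IsSLSolution.energy (hl : 0 < l) (hq : IntervalIntegrable q volume 0 l) {lam : ℂ}
    {y dy : ℝ → ℂ} (h : IsSLSolution q l lam y dy) :
    dy l * starRingEnd ℂ (y l) - dy 0 * starRingEnd ℂ (y 0) =
      ∫ x in (0 : ℝ)..l, ((Complex.normSq (dy x - centeredPrimitive q l x * y x) : ℂ) +
        (meanValue q l - (centeredPrimitive q l x : ℂ) ^ 2 - lam) * Complex.normSq (y x)) := by
  set Q := centeredPrimitive q l with hQ
  have hQc : ContinuousOn (fun x => (Q x : ℂ)) (Icc 0 l) :=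
    Complex.continuous_ofReal.comp_continuousOn (continuousOn_centeredPrimitive hl.le hq)
  set u : ℝ → ℂ := fun x => dy x - Q x * y x with hu
  have huc : ContinuousOn u (Icc 0 l) := h.continuousOn_deriv.sub (hQc.mul h.continuousOn)
  have hyc := h.continuousOn
  obtain ⟨h1, h2⟩ := (isSLSolution_iff_regularized (lam := lam) hl.le hq hyc huc).1
    (by simpa [hu, hQ] using h)
  rw [← hQ] at h1 h2
  set v : ℝ → ℂ := fun t => (meanValue q l - (Q t : ℂ) ^ 2 - lam) * y t - Q t * u t with hv
  have hvc : ContinuousOn v (Icc 0 l) :=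
    (((continuousOn_const.sub (hQc.pow 2)).sub continuousOn_const).mul hyc).sub (hQc.mul huc)
  have hwc : ContinuousOn (fun t => u t + Q t * y t) (Icc 0 l) := huc.add (hQc.mul hyc)
  have hconj : ContinuousOn (fun x => starRingEnd ℂ (y x)) (Icc 0 l) :=
    Complex.continuous_conj.comp_continuousOn hyc
  have hderiv : ∀ x ∈ Ioo 0 l, HasDerivAt (fun x => u x * starRingEnd ℂ (y x))
      (v x * starRingEnd ℂ (y x) + u x * starRingEnd ℂ (u x + Q x * y x)) x := by
    intro x hx
    have hx' := Ioo_subset_Icc_self hx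
    have hmem : Icc 0 l ∈ nhds x := Icc_mem_nhds hx.1 hx.2
    have hy' : HasDerivAt y (u x + Q x * y x) x :=
      (((hasDerivWithinAt_primitive hwc hx').const_add (y 0)).congr h1 (h1 x hx')).hasDerivAt hmem
    have hu' : HasDerivAt u (v x) x :=
      (((hasDerivWithinAt_primitive hvc hx').const_add (u 0)).congr h2 (h2 x hx')).hasDerivAt hmem
    exact hu'.mul hy'.star
  have hdc : ContinuousOn
      (fun x => v x * starRingEnd ℂ (y x) + u x * starRingEnd ℂ (u x + Q x * y x)) (Icc 0 l) :=
    (hvc.mul hconj).add (huc.mul (Complex.continuous_conj.comp_continuousOn hwc))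
  have h3 := intervalIntegral.integral_eq_sub_of_hasDerivAt_of_le hl.le (huc.mul hconj) hderiv
    (hdc.intervalIntegrable_of_mem_Icc ⟨hl.le, le_rfl⟩)
  have hu0 : u 0 = dy 0 := by simp [hu, hQ]
  have hul : u l = dy l := by simp [hu, hQ, centeredPrimitive_self hl hq]
  have h4 : dy l * starRingEnd ℂ (y l) - dy 0 * starRingEnd ℂ (y 0) =
      u l * starRingEnd ℂ (y l) - u 0 * starRingEnd ℂ (y 0) := by rw [hu0, hul]
  refine (h4.trans h3.symm).trans ?_
  refine intervalIntegral.integral_congr fun x _ => ?_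
  simp only [hv, Complex.normSq_eq_conj_mul_self, map_add, map_mul, Complex.conj_ofReal]
  ring

/-- What the tree needs to know of an edge: the flux `[y' ȳ]₀ˡ` has imaginary part `-Im lam ∫ |y|²`,
and for `Re lam` far to the left it has real part at least `∫ |y|²`. -/
theorem exists_edge_energy (hl : 0 < l) (hq : IntervalIntegrable q volume 0 l) :
    ∃ Λ : ℝ, ∀ (lam : ℂ) (y dy : ℝ → ℂ), IsSLSolution q l lam y dy →
      ∃ S : ℝ, 0 ≤ S ∧ (S = 0 → y 0 = 0 ∧ dy 0 = 0) ∧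
        (dy l * starRingEnd ℂ (y l) - dy 0 * starRingEnd ℂ (y 0)).im = -lam.im * S ∧
        (lam.re ≤ -Λ → S ≤ (dy l * starRingEnd ℂ (y l) - dy 0 * starRingEnd ℂ (y 0)).re) := by
  have hQr := continuousOn_centeredPrimitive hl.le hq
  have hQc : ContinuousOn (fun x => (centeredPrimitive q l x : ℂ)) (Icc 0 l) :=
    Complex.continuous_ofReal.comp_continuousOn hQr
  obtain ⟨C, hC⟩ := isCompact_Icc.exists_bound_of_continuousOn hQr
  -- for `Re lam ≤ m - C² - 1` the weight `m - Q² - Re lam` of `|y|²` is at least `1`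
  refine ⟨C ^ 2 + 1 - meanValue q l, fun lam y dy h => ?_⟩
  have hyc := h.continuousOn
  have hNy : ContinuousOn (fun x => Complex.normSq (y x)) (Icc 0 l) :=
    Complex.continuous_normSq.comp_continuousOn hyc
  have hNu : ContinuousOn (fun x => Complex.normSq (dy x - centeredPrimitive q l x * y x))
      (Icc 0 l) :=
    Complex.continuous_normSq.comp_continuousOn (h.continuousOn_deriv.sub (hQc.mul hyc))
  have hii : ∀ {g : ℝ → ℝ}, ContinuousOn g (Icc 0 l) → IntervalIntegrable g volume 0 l :=
    fun hg => ContinuousOn.intervalIntegrable (by rwa [uIcc_of_le hl.le])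
  have hcint : IntervalIntegrable (fun x =>
      (Complex.normSq (dy x - centeredPrimitive q l x * y x) : ℂ) +
        (meanValue q l - (centeredPrimitive q l x : ℂ) ^ 2 - lam) * Complex.normSq (y x))
      volume 0 l := by
    refine ContinuousOn.intervalIntegrable_of_mem_Icc (l := l) ?_ ⟨hl.le, le_rfl⟩
    exact (Complex.continuous_ofReal.comp_continuousOn hNu).add
      (((continuousOn_const.sub (hQc.pow 2)).sub continuousOn_const).mul
        (Complex.continuous_ofReal.comp_continuousOn hNy))
  have hflux := h.energy hl hq
  refine ⟨∫ x in (0 : ℝ)..l, Complex.normSq (y x),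
    intervalIntegral.integral_nonneg hl.le fun x _ => Complex.normSq_nonneg _, fun hS => ?_, ?_, ?_⟩
  · have hzero : ∀ x ∈ Icc 0 l, y x = 0 := by
      by_contra! hne
      obtain ⟨x, hx, hx0⟩ := hne
      have := intervalIntegral.integral_pos hl hNy (fun x _ => Complex.normSq_nonneg _)
        ⟨x, hx, Complex.normSq_pos.2 hx0⟩
      linarith
    have h0 : (0 : ℝ) ∈ Icc 0 l := ⟨le_rfl, hl.le⟩
    refine ⟨hzero 0 h0, ?_⟩
    have h1 : HasDerivWithinAt y (dy 0) (Icc 0 l) 0 :=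
      ((hasDerivWithinAt_primitive h.continuousOn_deriv h0).const_add (y 0)).congr h.eq_integral
        (h.eq_integral 0 h0)
    have h2 : HasDerivWithinAt y 0 (Icc 0 l) 0 :=
      (hasDerivWithinAt_const 0 (Icc 0 l) (0 : ℂ)).congr hzero (hzero 0 h0)
    exact (uniqueDiffOn_Icc hl 0 h0).eq_deriv _ h1 h2
  · have h1 := Complex.imCLM.intervalIntegral_comp_comm hcint
    simp only [Complex.imCLM_apply] at h1
    rw [hflux, ← h1, ← intervalIntegral.integral_const_mul]
    refine intervalIntegral.integral_congr fun x _ => ?_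
    simp [← Complex.ofReal_pow]
  · intro hlam
    have h1 := Complex.reCLM.intervalIntegral_comp_comm hcint
    simp only [Complex.reCLM_apply] at h1
    rw [hflux, ← h1]
    refine intervalIntegral.integral_mono_on hl.le (hii hNy) ⟨hcint.1.re, hcint.2.re⟩ fun x hx => ?_
    have h2 : centeredPrimitive q l x ^ 2 ≤ C ^ 2 := by
      rw [← sq_abs]
      exact pow_le_pow_left₀ (abs_nonneg _) (hC x hx) 2
    have h3 := Complex.normSq_nonneg (dy x - centeredPrimitive q l x * y x)
    have h4 := Complex.normSq_nonneg (y x)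
    simp only [← Complex.ofReal_pow, Complex.add_re, Complex.ofReal_re, Complex.mul_re,
      Complex.sub_re, Complex.ofReal_im, mul_zero, sub_zero]
    nlinarith

end Edge
end TreeJost

/-! ### The linear system on the tree -/

namespace TreeJost

open Set Matrix

lemma _root_.Differentiable.matrix_det_of_entries {n : Type*} [Fintype n] [DecidableEq n]
    {A : ℂ → Matrix n n ℂ} (hA : ∀ i j, Differentiable ℂ fun z => A z i j) :
    Differentiable ℂ fun z => (A z).det := by
  simp only [Matrix.det_apply]
  refine Differentiable.fun_sum fun σ _ => Differentiable.const_smul ?_ _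
  exact Differentiable.fun_finsetProd fun i _ => hA _ _

lemma det_bordered {n : Type*} [Fintype n] [DecidableEq n] {D : Matrix n n ℂ} (hD : IsUnit D.det)
    (b c : n → ℂ) :
    (fromBlocks (0 : Matrix Unit Unit ℂ) (of fun _ => b) (of fun i _ => c i) D).det =
      D.det * -(b ⬝ᵥ (D⁻¹ *ᵥ c)) := by
  let : Invertible D := ((Matrix.isUnit_iff_isUnit_det _).2 hD).invertible
  rw [det_fromBlocks₂₂]
  congr 1
  rw [det_unique, Matrix.sub_apply, Matrix.zero_apply, zero_sub,
    Matrix.mul_assoc, invOf_eq_nonsing_inv]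
  rfl

lemma exists_isChild_root {V : Type*} [Nontrivial V] {G : SimpleGraph V} (hG : G.Connected)
    (r : V) : ∃ u : {v : V // v ≠ r}, IsChild G r r u := by
  obtain ⟨u, hu⟩ := hG.preconnected.exists_adj_of_nontrivial r
  exact ⟨⟨u, hu.ne'⟩, hu, by simpa using SimpleGraph.dist_eq_one_iff_adj.2 hu⟩

section Tree

variable {V : Type*} [DecidableEq V] {G : SimpleGraph V} {r : V} {l : ℝ}
  {q : {v : V // v ≠ r} → ℝ → ℝ}

lemma differentiable_dirichletMatrix (hl : 0 < l)
    (hq : ∀ v, IntervalIntegrable (q v) volume 0 l) (i j : {v : V // v ≠ r} ⊕ {v : V // v ≠ r}) :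
    Differentiable ℂ fun lam => dirichletMatrix G r l q lam i j := by
  have hc : ∀ w, Differentiable ℂ (slC (q w) l) := fun w =>
    (differentiable_slSolution hl (hq w) 1 0).1
  have hc' : ∀ w, Differentiable ℂ (slC' (q w) l) := fun w =>
    (differentiable_slSolution hl (hq w) 1 0).2
  have hs : ∀ w, Differentiable ℂ (slS (q w) l) := fun w =>
    (differentiable_slSolution hl (hq w) 0 1).1
  have hs' : ∀ w, Differentiable ℂ (slS' (q w) l) := fun w =>
    (differentiable_slSolution hl (hq w) 0 1).2
  rcases i with u | u <;> rcases j with w | w <;>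
    simp only [dirichletMatrix, fromBlocks_apply₁₁, fromBlocks_apply₁₂, fromBlocks_apply₂₁,
      fromBlocks_apply₂₂, of_apply]
  · exact (differentiable_const _).sub ((hc w).const_mul _)
  · exact ((hs w).const_mul _).neg
  · split_ifs
    exacts [hc' u, differentiable_const _]
  · split_ifs
    exacts [(hs' u).sub (differentiable_const _), differentiable_const _]

variable [Fintype V]

lemma differentiable_phiD (hl : 0 < l) (hq : ∀ v, IntervalIntegrable (q v) volume 0 l) :
    Differentiable ℂ (phiD G r l q) :=
  Differentiable.matrix_det_of_entries (differentiable_dirichletMatrix hl hq)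

lemma differentiable_phiN (hl : 0 < l) (hq : ∀ v, IntervalIntegrable (q v) volume 0 l) :
    Differentiable ℂ (phiN G r l q) := by
  refine Differentiable.matrix_det_of_entries fun i j => ?_
  rcases i with u | u <;> rcases j with w | w <;>
    simp only [neumannMatrix, fromBlocks_apply₁₁, fromBlocks_apply₁₂, fromBlocks_apply₂₁,
      fromBlocks_apply₂₂]
  · exact differentiable_const _
  · exact differentiable_const _
  · exact differentiable_const _
  · exact differentiable_dirichletMatrix hl hq u w

/-- For a solution with the value `Y` at the root that satisfies all conditions except Kirchhoff's
condition at the root, the fluxes of all edges add up to the boundary term at the root: at every other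
vertex the incoming flux cancels the outgoing ones. -/
lemma sum_flux_eq {lam Y : ℂ} {X : {v : V // v ≠ r} ⊕ {v : V // v ≠ r} → ℂ}
    (hX : dirichletMatrix G r l q lam *ᵥ X = Sum.elim (fun u : {v : V // v ≠ r} => childInd G r r u * Y) 0) :
    ∑ u, ((X (.inl u) * slC' (q u) l lam + X (.inr u) * slS' (q u) l lam) *
        starRingEnd ℂ (X (.inl u) * slC (q u) l lam + X (.inr u) * slS (q u) l lam) -
        X (.inr u) * starRingEnd ℂ (X (.inl u))) =
      -(∑ u : {v : V // v ≠ r}, childInd G r r u * X (.inr u)) * starRingEnd ℂ Y := by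
  set y : {v : V // v ≠ r} → ℂ :=
    fun u => X (.inl u) * slC (q u) l lam + X (.inr u) * slS (q u) l lam with hy
  have hreal : ∀ u w, starRingEnd ℂ (childInd G r u w) = childInd G r u w := fun u w => by
    unfold childInd; split_ifs <;> simp
  have h1 : ∀ u, X (.inl u) =
      ∑ w : {v : V // v ≠ r}, childInd G r w u * y w + childInd G r r u * Y := by
    intro u
    have h := congrFun hX (.inl u)
    simp only [dirichletMatrix, mulVec, dotProduct, Fintype.sum_sum_type, fromBlocks_apply₁₁,
      fromBlocks_apply₁₂, of_apply, Sum.elim_inl, sub_mul, ite_mul, one_mul, zero_mul,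
      Finset.sum_sub_distrib, Finset.sum_ite_eq, Finset.mem_univ, if_true] at h
    rw [← h]
    have h2 : ∑ w : {v : V // v ≠ r}, childInd G r w u * y w =
        ∑ w : {v : V // v ≠ r}, childInd G r w u * slC (q w) l lam * X (.inl w) -
          ∑ w : {v : V // v ≠ r}, -(childInd G r w u * slS (q w) l lam) * X (.inr w) := by
      rw [← Finset.sum_sub_distrib]
      exact Finset.sum_congr rfl fun w _ => by simp only [hy]; ring
    rw [h2]
    ring
  have h2 : ∀ u, X (.inl u) * slC' (q u) l lam + X (.inr u) * slS' (q u) l lam =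
      ∑ w : {v : V // v ≠ r}, childInd G r u w * X (.inr w) := by
    intro u
    have h := congrFun hX (.inr u)
    simp only [dirichletMatrix, mulVec, dotProduct, Fintype.sum_sum_type, fromBlocks_apply₂₁,
      fromBlocks_apply₂₂, of_apply, Sum.elim_inr, sub_mul, ite_mul, zero_mul,
      Finset.sum_sub_distrib, Finset.sum_ite_eq, Finset.mem_univ, if_true, Pi.zero_apply] at h
    linear_combination h
  have h3 : ∑ u, X (.inr u) * starRingEnd ℂ (X (.inl u)) =
      ∑ u : {v : V // v ≠ r}, (∑ w : {v : V // v ≠ r}, childInd G r u w * X (.inr w)) *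
        starRingEnd ℂ (y u) +
      (∑ u : {v : V // v ≠ r}, childInd G r r u * X (.inr u)) * starRingEnd ℂ Y := by
    have h4 : ∀ u, X (.inr u) * starRingEnd ℂ (X (.inl u)) =
        ∑ w : {v : V // v ≠ r}, childInd G r w u * X (.inr u) * starRingEnd ℂ (y w) +
          childInd G r r u * X (.inr u) * starRingEnd ℂ Y := by
      intro u
      rw [h1 u, map_add, map_sum, mul_add, Finset.mul_sum]
      simp only [map_mul, hreal]
      congr 1
      · exact Finset.sum_congr rfl fun w _ => by ring
      · ring
    rw [Finset.sum_congr rfl fun u _ => h4 u, Finset.sum_add_distrib, Finset.sum_comm,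
      Finset.sum_mul]
    simp only [Finset.sum_mul]
  rw [Finset.sum_sub_distrib, h3, Finset.sum_congr rfl fun u _ => by rw [h2 u]]
  ring

theorem exists_tree_energy (hl : 0 < l) (hq : ∀ v, IntervalIntegrable (q v) volume 0 l) :
    ∃ Λ : ℝ, ∀ (lam Y : ℂ) (X : {v : V // v ≠ r} ⊕ {v : V // v ≠ r} → ℂ),
      dirichletMatrix G r l q lam *ᵥ X = Sum.elim (fun u : {v : V // v ≠ r} => childInd G r r u * Y) 0 →
      ∃ S : ℝ, 0 ≤ S ∧ (S = 0 → X = 0) ∧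
        (-(∑ u : {v : V // v ≠ r}, childInd G r r u * X (.inr u)) * starRingEnd ℂ Y).im =
          -lam.im * S ∧
        (lam.re ≤ -Λ →
          S ≤ (-(∑ u : {v : V // v ≠ r}, childInd G r r u * X (.inr u)) * starRingEnd ℂ Y).re) := by
  choose Λ hΛ using fun v => exists_edge_energy hl (hq v)
  obtain ⟨M, hM⟩ := (Set.finite_range Λ).bddAbove
  refine ⟨M, fun lam Y X hX => ?_⟩
  have hsol : ∀ u, ∃ S : ℝ, 0 ≤ S ∧ (S = 0 → X (.inl u) = 0 ∧ X (.inr u) = 0) ∧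
      ((X (.inl u) * slC' (q u) l lam + X (.inr u) * slS' (q u) l lam) *
        starRingEnd ℂ (X (.inl u) * slC (q u) l lam + X (.inr u) * slS (q u) l lam) -
        X (.inr u) * starRingEnd ℂ (X (.inl u))).im = -lam.im * S ∧
      (lam.re ≤ -M → S ≤ ((X (.inl u) * slC' (q u) l lam + X (.inr u) * slS' (q u) l lam) *
        starRingEnd ℂ (X (.inl u) * slC (q u) l lam + X (.inr u) * slS (q u) l lam) -
        X (.inr u) * starRingEnd ℂ (X (.inl u))).re) := by
    intro u
    obtain ⟨hc, hc0, hc1⟩ := slSolution_spec hl (hq u) lam 1 0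
    obtain ⟨hs, hs0, hs1⟩ := slSolution_spec hl (hq u) lam 0 1
    obtain ⟨S, h1, h2, h3, h4⟩ := hΛ u lam _ _
      (hc.linear_combination (hq u) hs (X (.inl u)) (X (.inr u)))
    simp only [hc0, hc1, hs0, hs1, mul_zero, mul_one, zero_add, add_zero] at h2 h3 h4
    exact ⟨S, h1, h2, h3, fun h => h4 (h.trans (neg_le_neg (hM (mem_range_self u))))⟩
  choose S h1 h2 h3 h4 using hsol
  rw [← sum_flux_eq hX]
  refine ⟨∑ u, S u, Finset.sum_nonneg fun u _ => h1 u, fun h => ?_, ?_, fun h => ?_⟩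
  · rw [Finset.sum_eq_zero_iff_of_nonneg fun u _ => h1 u] at h
    ext (u | u)
    exacts [(h2 u (h u (Finset.mem_univ u))).1, (h2 u (h u (Finset.mem_univ u))).2]
  · rw [Complex.im_sum, Finset.mul_sum]
    exact Finset.sum_congr rfl fun u _ => h3 u
  · rw [Complex.re_sum]
    exact Finset.sum_le_sum fun u _ => h4 u h

/-- The function `phiN / phiD` is defined and has imaginary part of sign opposite to that of `lam` off
the real axis, and it has positive real part far to the left. -/
theorem phiD_ne_zero_and_energy [Nontrivial V] (hG : G.Connected) (hl : 0 < l)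
    (hq : ∀ v, IntervalIntegrable (q v) volume 0 l) :
    ∃ Λ : ℝ, ∀ lam : ℂ, lam.im ≠ 0 ∨ lam.re ≤ -Λ →
      phiD G r l q lam ≠ 0 ∧ ∃ S : ℝ, 0 < S ∧
        (phiN G r l q lam / phiD G r l q lam).im = -lam.im * S ∧
        (lam.re ≤ -Λ → 0 < (phiN G r l q lam / phiD G r l q lam).re) := by
  obtain ⟨Λ, hΛ⟩ := exists_tree_energy (G := G) hl hq
  refine ⟨Λ, fun lam hlam => ?_⟩
  have hD : phiD G r l q lam ≠ 0 := by
    intro h0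
    obtain ⟨X, hX0, hX⟩ := Matrix.exists_mulVec_eq_zero_iff.2 h0
    obtain ⟨S, h1, h2, h3, h4⟩ := hΛ lam 0 X (by
      rw [hX]; ext (u | u) <;> simp)
    simp only [map_zero, mul_zero, Complex.zero_im, Complex.zero_re] at h3 h4
    refine hX0 (h2 ?_)
    rcases hlam with h | h
    · simpa [h] using h3.symm
    · exact le_antisymm (h4 h) h1
  refine ⟨hD, ?_⟩
  -- the solution with the value `1` at the root
  have hunit : IsUnit (dirichletMatrix G r l q lam).det := isUnit_iff_ne_zero.2 hD
  set X : {v : V // v ≠ r} ⊕ {v : V // v ≠ r} → ℂ := (dirichletMatrix G r l q lam)⁻¹ *ᵥ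
    Sum.elim (fun u : {v : V // v ≠ r} => childInd G r r u * 1) 0 with hXdef
  have hX : dirichletMatrix G r l q lam *ᵥ X = Sum.elim (fun u : {v : V // v ≠ r} => childInd G r r u * 1) 0 := by
    rw [hXdef, mulVec_mulVec, mul_nonsing_inv _ hunit, one_mulVec]
  have hdiv : phiN G r l q lam / phiD G r l q lam =
      -(∑ u : {v : V // v ≠ r}, childInd G r r u * X (.inr u)) * starRingEnd ℂ 1 := by
    have h1 := det_bordered hunit
      (Sum.elim (fun _ => 0) (fun w : {v : V // v ≠ r} => -childInd G r r w))
      (Sum.elim (fun u : {v : V // v ≠ r} => -childInd G r r u) (fun _ => 0))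
    have h2 : (Sum.elim (fun u : {v : V // v ≠ r} => -childInd G r r u) (fun _ => 0) :
        {v : V // v ≠ r} ⊕ {v : V // v ≠ r} → ℂ) =
        -Sum.elim (fun u : {v : V // v ≠ r} => childInd G r r u * 1) 0 := by
      ext (u | u) <;> simp
    rw [div_eq_iff hD, mul_comm]
    refine h1.trans ?_
    rw [h2, mulVec_neg, dotProduct_neg, neg_neg, ← hXdef]
    simp [dotProduct, phiD]
  obtain ⟨S, h1, h2, h3, h4⟩ := hΛ lam 1 X hX
  have hS : 0 < S := by
    -- the edges at the root start with the value `1`, so the solution is not zero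
    refine lt_of_le_of_ne h1 fun h0 => ?_
    obtain ⟨u, hu⟩ := exists_isChild_root hG r
    have h5 := congrFun hX (.inl u)
    rw [h2 h0.symm] at h5
    simp [childInd, hu] at h5
  rw [hdiv]
  exact ⟨S, hS, h3, fun h => hS.trans_le (h4 h)⟩

end Tree
end TreeJost

/-! ### Functions that reverse the sign of the imaginary part -/

namespace TreeJost

open Set Filter Topology

lemma tendsto_ray (x₀ : ℝ) {w : ℂ} (hw : w ≠ 0) :
    Tendsto (fun t : ℝ => (x₀ : ℂ) + t * w) (𝓝[>] 0) (𝓝[≠] (x₀ : ℂ)) := by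
  refine tendsto_nhdsWithin_iff.2 ⟨?_, ?_⟩
  · have : Continuous fun t : ℝ => (x₀ : ℂ) + t * w := by fun_prop
    simpa using (this.tendsto 0).mono_left nhdsWithin_le_nhds
  · filter_upwards [self_mem_nhdsWithin] with t ht
    simp [hw, (mem_Ioi.1 ht).ne']

lemma im_eq_zero_of_im_mul_im_neg {h : ℂ → ℂ} {x₀ : ℝ} (hh : ContinuousAt h x₀)
    (hsign : ∀ᶠ z in 𝓝 (x₀ : ℂ), z.im ≠ 0 → (h z).im * z.im < 0) : (h x₀).im = 0 := by
  have key : ∀ w : ℂ, w ≠ 0 → Tendsto (fun t : ℝ => (h (x₀ + t * w)).im) (𝓝[>] 0)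
      (𝓝 (h x₀).im) := fun w hw =>
    (Complex.continuous_im.tendsto _).comp
      (hh.tendsto.comp ((tendsto_ray x₀ hw).mono_right nhdsWithin_le_nhds))
  have hs : ∀ w : ℂ, w ≠ 0 → ∀ᶠ t : ℝ in 𝓝[>] 0, ((x₀ : ℂ) + t * w).im ≠ 0 →
      (h (x₀ + t * w)).im * ((x₀ : ℂ) + t * w).im < 0 := fun w hw =>
    ((tendsto_ray x₀ hw).mono_right nhdsWithin_le_nhds).eventually hsign
  apply le_antisymm
  · refine le_of_tendsto (key Complex.I Complex.I_ne_zero) ?_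
    filter_upwards [hs Complex.I Complex.I_ne_zero, self_mem_nhdsWithin] with t h1 h2
    have h2 : 0 < t := h2
    have h3 := h1 (by simp [h2.ne'])
    simp at h3
    nlinarith
  · refine ge_of_tendsto (key (-Complex.I) (by simp)) ?_
    filter_upwards [hs (-Complex.I) (by simp), self_mem_nhdsWithin] with t h1 h2
    have h2 : 0 < t := h2
    have h3 := h1 (by simp [h2.ne'])
    simp at h3
    rw [mul_neg]
    nlinarith

/-- For `n ≥ 2` the powers `w ^ n` of points of the upper half-plane cover all directions but at most
one. -/
lemma exists_im_mul_pow_pos {a : ℂ} (ha : a ≠ 0) {n : ℕ} (hn : 2 ≤ n) :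
    ∃ w : ℂ, 0 < w.im ∧ 0 < (a * w ^ n).im := by
  have hπ := Real.pi_pos
  obtain ⟨α, h0, h1, h2⟩ : ∃ α : ℝ, 0 < α ∧ α < 2 * Real.pi ∧ 0 < Real.sin (a.arg + α) := by
    rcases lt_or_ge a.arg (Real.pi / 2) with h | h
    · refine ⟨Real.pi / 2 - a.arg, by linarith, by linarith [Complex.neg_pi_lt_arg a], ?_⟩
      simp
    · refine ⟨2 * Real.pi + Real.pi / 4 - a.arg, by linarith [Complex.arg_le_pi a], by linarith, ?_⟩
      rw [show a.arg + (2 * Real.pi + Real.pi / 4 - a.arg) = Real.pi / 4 + 2 * Real.pi by ring,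
        Real.sin_add_two_pi]
      exact Real.sin_pos_of_pos_of_lt_pi (by linarith) (by linarith)
  have hn' : (2 : ℝ) ≤ n := by exact_mod_cast hn
  refine ⟨Complex.exp ((α / n : ℝ) * Complex.I), ?_, ?_⟩
  · rw [Complex.exp_ofReal_mul_I_im]
    refine Real.sin_pos_of_pos_of_lt_pi (by positivity) ?_
    rw [div_lt_iff₀ (by positivity)]
    nlinarith
  · rw [← Complex.exp_nat_mul]
    have h3 : (n : ℂ) * ((α / n : ℝ) * Complex.I) = α * Complex.I := by
      have : (n : ℂ) ≠ 0 := by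
        rw [Nat.cast_ne_zero]; omega
      push_cast
      field_simp
    have h4 : a * Complex.exp (α * Complex.I) =
        (‖a‖ : ℂ) * Complex.exp ((a.arg + α : ℝ) * Complex.I) := by
      conv_lhs => rw [← Complex.norm_mul_exp_arg_mul_I a]
      rw [mul_assoc, ← Complex.exp_add]
      push_cast
      ring_nf
    rw [h3, h4, Complex.im_ofReal_mul, Complex.exp_ofReal_mul_I_im]
    exact mul_pos (norm_pos_iff.2 ha) h2

/-- If `h` reverses the sign of the imaginary part near a real point, its derivative there is negative.
With the leading term `a (z - x₀) ^ n` of `h - h x₀`, the exponent `n ≥ 2` is excluded by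
`exists_im_mul_pow_pos`, and for `n = 1` the directions `w` of the upper half-plane satisfy
`Im (a w) ≤ 0`, which forces `a ≠ 0` to be real and negative. -/
theorem deriv_neg_of_im_mul_im_neg {h : ℂ → ℂ} {x₀ : ℝ} (hh : AnalyticAt ℂ h x₀)
    (hsign : ∀ᶠ z in 𝓝 (x₀ : ℂ), z.im ≠ 0 → (h z).im * z.im < 0) :
    ∃ d : ℝ, d < 0 ∧ HasDerivAt h d x₀ := by
  have him := im_eq_zero_of_im_mul_im_neg hh.continuousAt hsign
  have hsub : AnalyticAt ℂ (fun z => h z - h x₀) x₀ := hh.sub analyticAt_const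
  have htop : analyticOrderAt (fun z => h z - h x₀) (x₀ : ℂ) ≠ ⊤ := by
    intro htop
    rw [analyticOrderAt_eq_top] at htop
    obtain ⟨t, ⟨h1, h2⟩, h3⟩ := ((((tendsto_ray x₀ Complex.I_ne_zero).mono_right
      nhdsWithin_le_nhds).eventually (hsign.and htop)).and self_mem_nhdsWithin).exists
    have h3 : 0 < t := h3
    have h4 := h1 (by simp [h3.ne'])
    rw [sub_eq_zero.1 h2, him] at h4
    simp at h4
  obtain ⟨k, hk, hk0, hkeq⟩ := hsub.analyticOrderAt_ne_top.1 htop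
  set n := analyticOrderNatAt (fun z => h z - h x₀) (x₀ : ℂ) with hn
  have hdir : ∀ w : ℂ, 0 < w.im → (k x₀ * w ^ n).im ≤ 0 := by
    intro w hw
    have hw0 : w ≠ 0 := by rintro rfl; simp at hw
    have hray := (tendsto_ray x₀ hw0).mono_right nhdsWithin_le_nhds
    have h1 : Tendsto (fun t : ℝ => (k (x₀ + t * w) * w ^ n).im) (𝓝[>] 0) (𝓝 (k x₀ * w ^ n).im) :=
      (Complex.continuous_im.tendsto _).comp ((hk.continuousAt.tendsto.comp hray).mul_const _)
    refine le_of_tendsto h1 ?_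
    filter_upwards [hray.eventually (hsign.and hkeq), self_mem_nhdsWithin] with t h2 h3
    have h3 : 0 < t := h3
    have h4 := h2.1 (by simp [h3.ne', hw.ne'])
    have h5 : h (x₀ + t * w) = h x₀ + ((t ^ n : ℝ) : ℂ) * (k (x₀ + t * w) * w ^ n) := by
      have := h2.2
      simp only [add_sub_cancel_left, smul_eq_mul] at this
      push_cast
      linear_combination this
    rw [h5, Complex.add_im, him, zero_add, Complex.im_ofReal_mul] at h4
    have h6 : ((x₀ : ℂ) + t * w).im = t * w.im := by simp
    rw [h6] at h4
    have h7 : 0 < t ^ n := by positivity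
    have h8 : 0 < t * w.im := by positivity
    by_contra! h9
    have : 0 < t ^ n * (k (x₀ + t * w) * w ^ n).im * (t * w.im) := by positivity
    linarith
  have hn0 : n ≠ 0 := by
    intro h0
    have := hkeq.self_of_nhds
    simp [h0] at this
    exact hk0 this.symm
  have hn1 : n = 1 := by
    by_contra hne
    obtain ⟨w, h1, h2⟩ := exists_im_mul_pow_pos hk0 (n := n) (by omega)
    exact absurd (hdir w h1) (not_le.2 h2)
  rw [hn1] at hdir hkeq
  have hre : (k x₀).re ≤ 0 := by
    have := hdir Complex.I (by simp)
    simpa using this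
  have him0 : (k x₀).im = 0 := by
    -- a direction `w` with `Im (k x₀ * w) = 1`
    have h1 := hdir (((1 - (k x₀).re) / (k x₀).im : ℝ) + Complex.I) (by simp)
    by_contra hne
    simp only [pow_one, Complex.mul_im, Complex.add_im, Complex.ofReal_im, Complex.I_im,
      Complex.add_re, Complex.ofReal_re, Complex.I_re] at h1
    have h2 : (k x₀).im * ((1 - (k x₀).re) / (k x₀).im) = 1 - (k x₀).re := by field_simp
    linarith
  have hkreal : k x₀ = ((k x₀).re : ℂ) := Complex.ext (by simp) (by simp [him0])
  refine ⟨(k x₀).re, lt_of_le_of_ne hre fun h0 => hk0 (by rw [hkreal, h0]; simp), ?_⟩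
  rw [← hkreal]
  have h1 : HasDerivAt (fun z => h x₀ + (z - x₀) * k z) (k x₀) x₀ := by
    have := (((hasDerivAt_id (x₀ : ℂ)).sub_const (x₀ : ℂ)).mul
      hk.differentiableAt.hasDerivAt).const_add (h x₀)
    simpa using this
  refine h1.congr_of_eventuallyEq ?_
  filter_upwards [hkeq] with z hz
  simp only [pow_one, smul_eq_mul] at hz
  linear_combination hz

/-! ### Counting zeros between the poles of a decreasing function -/

lemma setOf_lt_eq {P : Set ℝ} {x y : ℝ} (hxy : x ≤ y) (h : ∀ z ∈ Ico x y, z ∉ P) :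
    {p ∈ P | p < x} = {p ∈ P | p < y} := by
  ext p
  simp only [mem_ofPred_eq, and_congr_right_iff]
  exact fun hp => ⟨fun h1 => h1.trans_le hxy, fun h1 => by
    by_contra! h2
    exact h p ⟨h2, h1⟩ hp⟩

lemma notMem_of_setOf_lt_eq {P : Set ℝ} {x y : ℝ} (hy : y ∉ P)
    (h : {p ∈ P | p < x} = {p ∈ P | p < y}) : ∀ z ∈ Icc x y, z ∉ P := by
  intro z hz hzP
  have h1 : z ∈ {p ∈ P | p < y} := ⟨hzP, lt_of_le_of_ne hz.2 fun h => hy (h ▸ hzP)⟩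
  rw [← h] at h1
  exact absurd h1.2 (not_lt.2 hz.1)

lemma strictAntiOn_of_hasDerivAt_neg {m : ℝ → ℝ} {P : Set ℝ}
    (hm : ∀ x < 0, x ∉ P → ∃ d < 0, HasDerivAt m d x) {x y : ℝ} (hy : y < 0)
    (h : ∀ z ∈ Icc x y, z ∉ P) : StrictAntiOn m (Icc x y) := by
  refine strictAntiOn_of_deriv_neg (convex_Icc x y) (fun z hz => ?_) fun z hz => ?_
  · obtain ⟨d, -, hd⟩ := hm z (hz.2.trans_lt hy) (h z hz)
    exact hd.continuousAt.continuousWithinAt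
  · have hz := interior_subset hz
    obtain ⟨d, hd0, hd⟩ := hm z (hz.2.trans_lt hy) (h z hz)
    rwa [hd.deriv]

/-- The set of the poles to the left of `x` determines the interval between poles in which `x` lies, and
such an interval has at most one zero. -/
lemma injOn_setOf_lt_of_strictAnti {m : ℝ → ℝ} {P : Set ℝ}
    (hm : ∀ x y, y < 0 → (∀ z ∈ Icc x y, z ∉ P) → StrictAntiOn m (Icc x y)) :
    InjOn (fun x => {p ∈ P | p < x}) {x | x < 0 ∧ x ∉ P ∧ m x = 0} := by
  intro x hx y hy hxy
  by_contra hne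
  wlog hlt : x < y generalizing x y
  · exact this hy hx hxy.symm (Ne.symm hne) (lt_of_le_of_ne (not_lt.1 hlt) (Ne.symm hne))
  have h1 := hm x y hy.1 (notMem_of_setOf_lt_eq hy.2.1 hxy)
    (left_mem_Icc.2 hlt.le) (right_mem_Icc.2 hlt.le) hlt
  rw [hx.2.2, hy.2.2] at h1
  exact lt_irrefl _ h1

/-- Here `P` is the set of the poles of `m` on the negative half-axis. The zeros of `m` and of
`m + √(-x)` lie in the same intervals between the poles, at most one in each. To the right of a
zero of `m` the sum `m + √(-x)` becomes negative before the interval ends: at a pole because `m` tends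
to `-∞`, and at `0` because the square root tends to `0`. To the left of a zero of `m + √(-x)`, where
`m` is negative, `m` becomes positive. -/
theorem ncard_zeros_eq_ncard_zeros_add_sqrt {m : ℝ → ℝ} {P : Set ℝ} {Λ : ℝ} (hP : P.Finite)
    (hm : ∀ x < 0, x ∉ P → ∃ d < 0, HasDerivAt m d x)
    (hleft : ∀ p ∈ P, Tendsto m (𝓝[<] p) atBot) (hright : ∀ p ∈ P, Tendsto m (𝓝[>] p) atTop)
    (hinf : ∀ x ≤ -Λ, 0 < m x) :
    {x | x < 0 ∧ x ∉ P ∧ m x = 0}.ncard = {x | x < 0 ∧ x ∉ P ∧ m x + √(-x) = 0}.ncard := by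
  have hanti : ∀ x y, y < 0 → (∀ z ∈ Icc x y, z ∉ P) → StrictAntiOn m (Icc x y) :=
    fun x y hy h => strictAntiOn_of_hasDerivAt_neg hm hy h
  have hanti' : ∀ x y, y < 0 → (∀ z ∈ Icc x y, z ∉ P) →
      StrictAntiOn (fun x => m x + √(-x)) (Icc x y) := fun x y hy h =>
    (hanti x y hy h).add_antitone fun a _ b _ hab => Real.sqrt_le_sqrt (neg_le_neg hab)
  have hcont : ∀ x y, y < 0 → (∀ z ∈ Icc x y, z ∉ P) → ContinuousOn m (Icc x y) := by
    intro x y hy h z hz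
    obtain ⟨d, -, hd⟩ := hm z (hz.2.trans_lt hy) (h z hz)
    exact hd.continuousAt.continuousWithinAt
  have hcont' : ∀ x y, y < 0 → (∀ z ∈ Icc x y, z ∉ P) →
      ContinuousOn (fun x => m x + √(-x)) (Icc x y) := fun x y hy h =>
    (hcont x y hy h).add (by fun_prop)
  have himage : (fun x => {p ∈ P | p < x}) '' {x | x < 0 ∧ x ∉ P ∧ m x = 0} =
      (fun x => {p ∈ P | p < x}) '' {x | x < 0 ∧ x ∉ P ∧ m x + √(-x) = 0} := by
    apply Subset.antisymm
    · rintro _ ⟨x, ⟨hx0, hxP, hx⟩, rfl⟩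
      obtain ⟨b, hxb, hb0, hbP, hb⟩ : ∃ b, x < b ∧ b < 0 ∧ (∀ z ∈ Icc x b, z ∉ P) ∧
          m b + √(-b) < 0 := by
        rcases {p ∈ P | x < p ∧ p < 0}.eq_empty_or_nonempty with he | hne
        · have hno : ∀ b < 0, ∀ z ∈ Icc x b, z ∉ P := by
            intro b hb z hz hzP
            have : z ∈ {p ∈ P | x < p ∧ p < 0} :=
              ⟨hzP, lt_of_le_of_ne hz.1 fun h => hxP (h ▸ hzP), hz.2.trans_lt hb⟩
            simp [he] at this
          have h1 : m (x / 2) < 0 := by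
            have := hanti x (x / 2) (by linarith) (hno _ (by linarith))
              (left_mem_Icc.2 (by linarith)) (right_mem_Icc.2 (by linarith)) (by linarith)
            linarith
          -- a point so close to `0` that the square root does not outweigh `m (x / 2) < 0`
          set b := max (x / 2) (-(m (x / 2) / 2) ^ 2) with hb
          have hb0 : b < 0 := max_lt (by linarith) (by nlinarith)
          have hxb : x / 2 ≤ b := le_max_left _ _
          refine ⟨b, by linarith, hb0, hno b hb0, ?_⟩
          have h2 : m b ≤ m (x / 2) := (hanti x b hb0 (hno b hb0)).antitoneOn
            ⟨by linarith, hxb⟩ (right_mem_Icc.2 (by linarith)) hxb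
          have h3 : √(-b) ≤ -(m (x / 2) / 2) := by
            refine Real.sqrt_le_iff.2 ⟨by linarith, ?_⟩
            have : -(m (x / 2) / 2) ^ 2 ≤ b := le_max_right _ _
            linarith [neg_sq (m (x / 2) / 2)]
          linarith
        · obtain ⟨p, ⟨hpP, hxp, hp0⟩, hmin⟩ :=
            exists_min_image _ id (hP.subset fun p hp => hp.1) hne
          obtain ⟨b, hb1, hb2, hb3⟩ := (((hleft p hpP).eventually
            (eventually_lt_atBot (-√(-x)))).and (Ioo_mem_nhdsLT hxp)).exists
          refine ⟨b, hb2, hb3.trans hp0, fun z hz hzP => ?_, ?_⟩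
          · have hz1 : x < z := lt_of_le_of_ne hz.1 fun h => hxP (h ▸ hzP)
            have hz2 : z < p := hz.2.trans_lt hb3
            exact absurd (hmin z ⟨hzP, hz1, hz2.trans hp0⟩) (not_le.2 hz2)
          · have : √(-b) ≤ √(-x) := Real.sqrt_le_sqrt (by linarith)
            linarith
      have hx1 : 0 < m x + √(-x) := by
        rw [hx, zero_add]
        exact Real.sqrt_pos.2 (by linarith)
      obtain ⟨y, hy, hy0⟩ := intermediate_value_Icc' hxb.le (hcont' x b hb0 hbP)
        (show (0 : ℝ) ∈ Icc _ _ from ⟨hb.le, hx1.le⟩)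
      refine ⟨y, ⟨hy.2.trans_lt hb0, hbP y hy, hy0⟩, ?_⟩
      exact (setOf_lt_eq hy.1 fun z hz => hbP z ⟨hz.1, hz.2.le.trans hy.2⟩).symm
    · rintro _ ⟨y, ⟨hy0, hyP, hy⟩, rfl⟩
      obtain ⟨a, hay, haP, ha⟩ : ∃ a, a < y ∧ (∀ z ∈ Icc a y, z ∉ P) ∧ 0 < m a := by
        rcases {p ∈ P | p < y}.eq_empty_or_nonempty with he | hne
        · refine ⟨min (-Λ) (y - 1), by simp, fun z hz hzP => ?_, hinf _ (min_le_left _ _)⟩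
          have : z ∈ {p ∈ P | p < y} := ⟨hzP, lt_of_le_of_ne hz.2 fun h => hyP (h ▸ hzP)⟩
          simp [he] at this
        · obtain ⟨p, ⟨hpP, hpy⟩, hmax⟩ := exists_max_image _ id (hP.subset fun p hp => hp.1) hne
          obtain ⟨a, ha1, ha2, ha3⟩ := (((hright p hpP).eventually
            (eventually_gt_atTop 0)).and (Ioo_mem_nhdsGT hpy)).exists
          refine ⟨a, ha3, fun z hz hzP => ?_, ha1⟩
          have hz1 : z < y := lt_of_le_of_ne hz.2 fun h => hyP (h ▸ hzP)
          exact absurd (hmax z ⟨hzP, hz1⟩) (not_le.2 (ha2.trans_le hz.1))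
      have hy1 : m y ≤ 0 := by linarith [Real.sqrt_nonneg (-y)]
      obtain ⟨x, hx, hx0⟩ := intermediate_value_Icc' hay.le (hcont a y hy0 haP)
        (show (0 : ℝ) ∈ Icc _ _ from ⟨hy1, ha.le⟩)
      refine ⟨x, ⟨hx.2.trans_lt hy0, haP x hx, hx0⟩, ?_⟩
      exact setOf_lt_eq hx.2 fun z hz => haP z ⟨hx.1.trans hz.1, hz.2.le⟩
  rw [← (injOn_setOf_lt_of_strictAnti hanti).ncard_image, himage,
    (injOn_setOf_lt_of_strictAnti hanti').ncard_image]

end TreeJost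

namespace TreeJost

open Set Filter Topology

/-! ### The square root of `-z` -/

lemma sqrt_sq (z : ℂ) : z.sqrt ^ 2 = z := by
  simp [Complex.sqrt]

lemma re_sqrt_pos {z : ℂ} (hz : z ∈ Complex.slitPlane) : 0 < z.sqrt.re := by
  rw [Complex.sqrt, Complex.cpow_inv_two_re]
  refine Real.sqrt_pos.2 ?_
  rcases hz with h | h
  · linarith [norm_nonneg z]
  · linarith [Complex.abs_re_lt_norm.2 h, neg_abs_le z.re]

lemma analyticAt_sqrt_neg {z : ℂ} (hz : z.re < 0) :
    AnalyticAt ℂ (fun z => Complex.sqrt (-z)) z := by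
  unfold Complex.sqrt
  exact AnalyticAt.cpow (by fun_prop) analyticAt_const (Or.inl (by simpa using hz))

lemma im_sqrt_neg_mul_im_neg {z : ℂ} (hre : z.re < 0) (him : z.im ≠ 0) :
    (Complex.sqrt (-z)).im * z.im < 0 := by
  have h1 : 0 < (Complex.sqrt (-z)).re := re_sqrt_pos (Or.inl (by simpa using hre))
  have h2 := congrArg Complex.im (sqrt_sq (-z))
  simp only [sq, Complex.mul_im, Complex.neg_im] at h2
  have h3 : z.im = -(2 * (Complex.sqrt (-z)).re * (Complex.sqrt (-z)).im) := by linarith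
  have h4 : (Complex.sqrt (-z)).im ≠ 0 := fun h0 => him (by rw [h3, h0]; simp)
  have h5 : 0 < (Complex.sqrt (-z)).re * (Complex.sqrt (-z)).im ^ 2 := by positivity
  rw [h3]
  linarith

lemma sqrt_neg_ofReal {x : ℝ} (hx : x < 0) : Complex.sqrt (-(x : ℂ)) = (√(-x) : ℝ) := by
  have h1 : 0 < (Complex.sqrt (-(x : ℂ))).re := re_sqrt_pos (Or.inl (by simpa using hx))
  have h2 := sqrt_sq (-(x : ℂ))
  have h3 : ((√(-x) : ℝ) : ℂ) ^ 2 = -(x : ℂ) := by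
    rw [← Complex.ofReal_pow, Real.sq_sqrt (by linarith)]
    simp
  refine (sq_eq_sq_iff_eq_or_eq_neg.1 (h2.trans h3.symm)).resolve_right fun h => ?_
  rw [h] at h1
  simp only [Complex.neg_re, Complex.ofReal_re] at h1
  linarith [Real.sqrt_nonneg (-x)]

lemma sqrt_neg_sq {τ : ℂ} (hτ : τ.im < 0) : Complex.sqrt (-τ ^ 2) = Complex.I * τ := by
  have h2 := sqrt_sq (-τ ^ 2)
  have h3 : (Complex.I * τ) ^ 2 = -τ ^ 2 := by rw [mul_pow, Complex.I_sq]; ring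
  have h1 : 0 ≤ (Complex.sqrt (-τ ^ 2)).re := by
    rw [Complex.sqrt, Complex.cpow_inv_two_re]
    exact Real.sqrt_nonneg _
  refine (sq_eq_sq_iff_eq_or_eq_neg.1 (h2.trans h3.symm)).resolve_right fun h => ?_
  rw [h] at h1
  simp at h1
  linarith

/-! ### Quotients that reverse the sign of the imaginary part -/

lemma exists_analyticAt_quotient {f g : ℂ → ℂ} {x : ℂ} (hf : AnalyticAt ℂ f x)
    (hg : AnalyticAt ℂ g x) (hf' : analyticOrderAt f x ≠ ⊤) (hg' : analyticOrderAt g x ≠ ⊤)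
    (h : analyticOrderNatAt g x ≤ analyticOrderNatAt f x) :
    ∃ m : ℂ → ℂ, AnalyticAt ℂ m x ∧ (∀ᶠ z in 𝓝 x, f z = m z * g z) ∧
      (analyticOrderNatAt g x < analyticOrderNatAt f x → m x = 0) := by
  obtain ⟨F, hF, hF0, hFeq⟩ := hf.analyticOrderAt_ne_top.1 hf'
  obtain ⟨K, hK, hK0, hKeq⟩ := hg.analyticOrderAt_ne_top.1 hg'
  refine ⟨fun z => (z - x) ^ (analyticOrderNatAt f x - analyticOrderNatAt g x) * (F z / K z),
    ?_, ?_, fun hlt => ?_⟩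
  · have := hF.fun_div hK hK0
    fun_prop
  · filter_upwards [hFeq, hKeq, hK.continuousAt.eventually_ne hK0] with z h1 h2 h3
    rw [h1, h2]
    simp only [smul_eq_mul]
    have h4 : (z - x) ^ analyticOrderNatAt f x =
        (z - x) ^ (analyticOrderNatAt f x - analyticOrderNatAt g x) *
          (z - x) ^ analyticOrderNatAt g x := by
      rw [← pow_add, Nat.sub_add_cancel h]
    rw [h4]
    field_simp
  · simp [Nat.sub_ne_zero_of_lt hlt]

open Classical in
lemma analyticOrderNatAt_of_eq_mul {f g m : ℂ → ℂ} {x d : ℂ} (hg : AnalyticAt ℂ g x)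
    (hm : AnalyticAt ℂ m x) (hg' : analyticOrderAt g x ≠ ⊤) (hd : HasDerivAt m d x) (hd0 : d ≠ 0)
    (h : ∀ᶠ z in 𝓝 x, f z = m z * g z) :
    analyticOrderNatAt f x = analyticOrderNatAt g x + if m x = 0 then 1 else 0 := by
  have h1 : analyticOrderAt m x = if m x = 0 then 1 else 0 := by
    split_ifs with h0
    · exact hm.analyticOrderAt_eq_one_of_zero_deriv_ne_zero h0 (by rwa [hd.deriv])
    · exact hm.analyticOrderAt_eq_zero.2 h0
  have h2 : analyticOrderAt m x ≠ ⊤ := by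
    rw [h1]; split_ifs <;> simp
  have h3 : f =ᶠ[𝓝 x] m * g := h
  rw [analyticOrderNatAt, analyticOrderAt_congr h3, ← analyticOrderNatAt,
    analyticOrderNatAt_mul hm hg h2 hg', add_comm, analyticOrderNatAt.eq_1 m, h1]
  split_ifs <;> simp

/-- The real part of the quotient `f / g` on the real axis, with removable singularities removed. At a
pole the value is irrelevant. -/
noncomputable def realQuotient (f g : ℂ → ℂ) (x : ℝ) : ℝ :=
  (limUnder (𝓝[≠] (x : ℂ)) fun z => f z / g z).re

lemma realQuotient_eq {f g m : ℂ → ℂ} {x : ℝ} (hm : ContinuousAt m x)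
    (h : ∀ᶠ z in 𝓝[≠] (x : ℂ), f z / g z = m z) : realQuotient f g x = (m x).re := by
  have h1 : Tendsto (fun z => f z / g z) (𝓝[≠] (x : ℂ)) (𝓝 (m x)) :=
    (hm.tendsto.mono_left nhdsWithin_le_nhds).congr' (h.mono fun z hz => hz.symm)
  rw [realQuotient, h1.limUnder_eq]

/-- Two entire functions `f` and `g` such that `g` has no zeros off the real axis and in the half-plane
`Re z ≤ -Λ`, and `f / g` reverses the sign of the imaginary part off the real axis and has positive
real part in that half-plane. -/
structure IsAntiHerglotzPair (f g : ℂ → ℂ) (Λ : ℝ) : Prop where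
  differentiable_left : Differentiable ℂ f
  differentiable_right : Differentiable ℂ g
  ne_zero_of_im_ne_zero : ∀ z : ℂ, z.im ≠ 0 → g z ≠ 0
  im_mul_im_neg : ∀ z : ℂ, z.im ≠ 0 → (f z / g z).im * z.im < 0
  ne_zero_of_re_le : ∀ z : ℂ, z.re ≤ -Λ → g z ≠ 0
  re_pos : ∀ z : ℂ, z.re ≤ -Λ → 0 < (f z / g z).re

namespace IsAntiHerglotzPair

variable {f g : ℂ → ℂ} {Λ : ℝ}

lemma ne_zero_left (h : IsAntiHerglotzPair f g Λ) {z : ℂ} (hz : z.im ≠ 0) : f z ≠ 0 := by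
  intro h0
  have := h.im_mul_im_neg z hz
  simp [h0] at this

lemma analyticOrderAt_ne_top_of_forall {F : ℂ → ℂ} (h : ∀ z : ℂ, z.im ≠ 0 → F z ≠ 0) (x : ℂ) :
    analyticOrderAt F x ≠ ⊤ := by
  intro htop
  rw [analyticOrderAt_eq_top] at htop
  have hray : Tendsto (fun t : ℝ => x + t * Complex.I) (𝓝[≠] 0) (𝓝 x) := by
    have : Continuous fun t : ℝ => x + t * Complex.I := by fun_prop
    simpa using (this.tendsto 0).mono_left nhdsWithin_le_nhds
  have h1 : ∀ᶠ t : ℝ in 𝓝[≠] 0, (x + t * Complex.I).im ≠ 0 := by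
    have : ∀ᶠ t : ℝ in 𝓝[≠] 0, t ≠ -x.im := by
      rcases eq_or_ne x.im 0 with h0 | h0
      · filter_upwards [self_mem_nhdsWithin] with t ht
        simpa [h0] using ht
      · exact (eventually_ne_nhds (neg_ne_zero.2 h0).symm).filter_mono nhdsWithin_le_nhds
    filter_upwards [this] with t ht h2
    apply ht
    simp at h2
    linarith
  obtain ⟨t, h2, h3⟩ := ((hray.eventually htop).and h1).exists
  exact h _ h3 h2

lemma analyticOrderAt_left_ne_top (h : IsAntiHerglotzPair f g Λ) (x : ℂ) :
    analyticOrderAt f x ≠ ⊤ := analyticOrderAt_ne_top_of_forall (fun _ hz => h.ne_zero_left hz) x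

lemma analyticOrderAt_right_ne_top (h : IsAntiHerglotzPair f g Λ) (x : ℂ) :
    analyticOrderAt g x ≠ ⊤ := analyticOrderAt_ne_top_of_forall h.ne_zero_of_im_ne_zero x

lemma analyticAt_left (h : IsAntiHerglotzPair f g Λ) (x : ℂ) : AnalyticAt ℂ f x :=
  h.differentiable_left.analyticAt x

lemma analyticAt_right (h : IsAntiHerglotzPair f g Λ) (x : ℂ) : AnalyticAt ℂ g x :=
  h.differentiable_right.analyticAt x

lemma eventually_right_ne_zero (h : IsAntiHerglotzPair f g Λ) (x : ℂ) :
    ∀ᶠ z in 𝓝[≠] x, g z ≠ 0 :=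
  (h.analyticAt_right x).eventually_eq_zero_or_eventually_ne_zero.resolve_left fun h0 =>
    h.analyticOrderAt_right_ne_top x (analyticOrderAt_eq_top.2 h0)

lemma realQuotient_pos (h : IsAntiHerglotzPair f g Λ) {x : ℝ} (hx : x ≤ -Λ) :
    0 < realQuotient f g x := by
  rw [realQuotient_eq (m := fun z => f z / g z)
    (((h.analyticAt_left x).continuousAt).div (h.analyticAt_right x).continuousAt
      (h.ne_zero_of_re_le x (by simpa using hx))) (Eventually.of_forall fun z => rfl)]
  exact h.re_pos x (by simpa using hx)

/-- At a real point that is not a pole, the quotient has an analytic extension `m`, and it decreases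
along the real axis. -/
lemma exists_local_quotient (h : IsAntiHerglotzPair f g Λ) {x : ℝ}
    (hx : analyticOrderNatAt g (x : ℂ) ≤ analyticOrderNatAt f (x : ℂ)) :
    ∃ m : ℂ → ℂ, AnalyticAt ℂ m x ∧ (∀ᶠ z in 𝓝 (x : ℂ), f z = m z * g z) ∧
      (∀ᶠ z in 𝓝 (x : ℂ), z.im ≠ 0 → (m z).im * z.im < 0) ∧ m x = realQuotient f g x ∧
      ∃ d < 0, HasDerivAt (realQuotient f g) d x := by
  obtain ⟨m, hm, hfm, -⟩ := exists_analyticAt_quotient (h.analyticAt_left x) (h.analyticAt_right x)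
    (h.analyticOrderAt_left_ne_top x) (h.analyticOrderAt_right_ne_top x) hx
  have hsign : ∀ᶠ z in 𝓝 (x : ℂ), z.im ≠ 0 → (m z).im * z.im < 0 := by
    filter_upwards [hfm] with z hz him
    have h1 := h.im_mul_im_neg z him
    rwa [hz, mul_div_cancel_right₀ _ (h.ne_zero_of_im_ne_zero z him)] at h1
  obtain ⟨d, hd0, hd⟩ := deriv_neg_of_im_mul_im_neg hm hsign
  have hq : ∀ᶠ y : ℝ in 𝓝 x, realQuotient f g y = (m y).re := by
    have h1 : ∀ᶠ z in 𝓝 (x : ℂ), AnalyticAt ℂ m z ∧ ∀ᶠ w in 𝓝 z, f w = m w * g w :=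
      hm.eventually_analyticAt.and hfm.eventually_nhds
    filter_upwards [Complex.continuous_ofReal.continuousAt.eventually h1] with y hy
    refine realQuotient_eq hy.1.continuousAt ?_
    filter_upwards [hy.2.filter_mono nhdsWithin_le_nhds, h.eventually_right_ne_zero y] with z h2 h3
    rw [h2, mul_div_cancel_right₀ _ h3]
  refine ⟨m, hm, hfm, hsign, ?_, d, hd0, ?_⟩
  · rw [hq.self_of_nhds]
    exact Complex.ext (by simp) (by simpa using im_eq_zero_of_im_mul_im_neg hm.continuousAt hsign)
  · have h2 := hd.real_of_complex
    rw [Complex.ofReal_re] at h2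
    exact h2.congr_of_eventuallyEq hq

/-- At a real pole the reciprocal quotient has an analytic extension `k` with `k x = 0`. It increases
along the real axis, so that the quotient tends to `-∞` from the left and to `+∞` from the right. -/
lemma exists_local_pole (h : IsAntiHerglotzPair f g Λ) {x : ℝ}
    (hx : analyticOrderNatAt f (x : ℂ) < analyticOrderNatAt g (x : ℂ)) :
    ∃ k : ℂ → ℂ, AnalyticAt ℂ k x ∧ k x = 0 ∧ (∀ᶠ z in 𝓝 (x : ℂ), g z = k z * f z) ∧
      Tendsto (realQuotient f g) (𝓝[<] x) atBot ∧ Tendsto (realQuotient f g) (𝓝[>] x) atTop := by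
  obtain ⟨k, hk, hgk, hk0⟩ := exists_analyticAt_quotient (h.analyticAt_right x)
    (h.analyticAt_left x) (h.analyticOrderAt_right_ne_top x) (h.analyticOrderAt_left_ne_top x) hx.le
  replace hk0 := hk0 hx
  -- `-k = -g / f` again reverses the sign of the imaginary part
  have hsign : ∀ᶠ z in 𝓝 (x : ℂ), z.im ≠ 0 → (-k z).im * z.im < 0 := by
    filter_upwards [hgk] with z hz him
    have h1 := h.im_mul_im_neg z him
    have hf0 := h.ne_zero_left him
    have hg0 := h.ne_zero_of_im_ne_zero z him
    have h2 : k z = (f z / g z)⁻¹ := by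
      rw [inv_div, hz, mul_div_cancel_right₀ _ hf0]
    rw [h2, Complex.neg_im, Complex.inv_im]
    have h3 : 0 < Complex.normSq (f z / g z) := Complex.normSq_pos.2 (div_ne_zero hf0 hg0)
    have h4 : -(-(f z / g z).im / Complex.normSq (f z / g z)) * z.im =
        ((f z / g z).im * z.im) / Complex.normSq (f z / g z) := by ring
    rw [h4]
    exact div_neg_of_neg_of_pos h1 h3
  obtain ⟨d, hd0, hd⟩ := deriv_neg_of_im_mul_im_neg hk.fun_neg hsign
  have hreal : ∀ᶠ y : ℝ in 𝓝 x, (-k y).im = 0 := by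
    have h1 := hk.fun_neg.eventually_analyticAt.and hsign.eventually_nhds
    filter_upwards [Complex.continuous_ofReal.continuousAt.eventually h1] with y hy
    exact im_eq_zero_of_im_mul_im_neg (h := fun z => -k z) hy.1.continuousAt hy.2
  set φ : ℝ → ℝ := fun y => (-k y).re with hφ
  have hdφ : HasDerivAt φ d x := by
    have := hd.real_of_complex
    rwa [Complex.ofReal_re] at this
  have hφ0 : φ x = 0 := by simp [hφ, hk0]
  have hslope : ∀ᶠ y in 𝓝[≠] x, (y - x)⁻¹ * φ y < 0 := by
    filter_upwards [(hasDerivAt_iff_tendsto_slope.1 hdφ).eventually_lt_const hd0] with y hy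
    simpa [slope, hφ0] using hy
  have hq : ∀ᶠ y in 𝓝[≠] x, realQuotient f g y = -(φ y)⁻¹ := by
    have h1 : ∀ᶠ z in 𝓝 (x : ℂ), AnalyticAt ℂ k z ∧ ∀ᶠ w in 𝓝 z, g w = k w * f w :=
      hk.eventually_analyticAt.and hgk.eventually_nhds
    filter_upwards [(Complex.continuous_ofReal.continuousAt.eventually h1).filter_mono
      nhdsWithin_le_nhds, hslope, hreal.filter_mono nhdsWithin_le_nhds] with y hy hs hr
    have hkre : k y = ((-φ y : ℝ) : ℂ) := Complex.ext (by simp [hφ]) (by simpa using hr)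
    have hφy : φ y ≠ 0 := by
      intro h0
      simp [h0] at hs
    have hky : k y ≠ 0 := by
      rw [hkre]
      exact_mod_cast neg_ne_zero.2 hφy
    rw [realQuotient_eq (m := fun z => (k z)⁻¹) (hy.1.continuousAt.inv₀ hky)]
    · rw [hkre, ← Complex.ofReal_inv, Complex.ofReal_re, inv_neg]
    · filter_upwards [hy.2.filter_mono nhdsWithin_le_nhds, h.eventually_right_ne_zero y]
        with z h2 h3
      have hf0 : f z ≠ 0 := fun h0 => h3 (by rw [h2, h0, mul_zero])
      rw [h2]
      field_simp
  have hcont : Tendsto φ (𝓝 x) (𝓝 0) := by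
    have := hdφ.continuousAt.tendsto
    rwa [hφ0] at this
  refine ⟨k, hk, hk0, hgk, ?_, ?_⟩
  · have h1 : Tendsto φ (𝓝[<] x) (𝓝[>] 0) := by
      refine tendsto_nhdsWithin_iff.2 ⟨hcont.mono_left nhdsWithin_le_nhds, ?_⟩
      filter_upwards [hslope.filter_mono (nhdsLT_le_nhdsNE x), self_mem_nhdsWithin] with y hy hyx
      have hyx : (y - x)⁻¹ < 0 := inv_lt_zero.2 (sub_neg.2 hyx)
      exact pos_of_mul_neg_right hy hyx.le
    refine (tendsto_neg_atTop_atBot.comp h1.inv_tendsto_nhdsGT_zero).congr' ?_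
    filter_upwards [hq.filter_mono (nhdsLT_le_nhdsNE x)] with y hy
    simp [hy]
  · have h1 : Tendsto (fun y => -φ y) (𝓝[>] x) (𝓝[>] 0) := by
      refine tendsto_nhdsWithin_iff.2 ⟨by simpa using hcont.neg.mono_left nhdsWithin_le_nhds, ?_⟩
      filter_upwards [hslope.filter_mono (nhdsGT_le_nhdsNE x), self_mem_nhdsWithin] with y hy hyx
      have hyx : 0 < (y - x)⁻¹ := inv_pos.2 (sub_pos.2 hyx)
      have : φ y < 0 := by
        by_contra! h0
        nlinarith [mul_nonneg hyx.le h0]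
      simpa using this
    refine h1.inv_tendsto_nhdsGT_zero.congr' ?_
    filter_upwards [hq.filter_mono (nhdsGT_le_nhdsNE x)] with y hy
    simp [hy, inv_neg]

end IsAntiHerglotzPair
end TreeJost

/-! ### Comparing the zeros -/

namespace TreeJost

open Set Filter Topology

lemma finite_zeros_of_isCompact {F : ℂ → ℂ} (hF : Differentiable ℂ F) {z₀ : ℂ} (hz₀ : F z₀ ≠ 0)
    {K : Set ℂ} (hK : IsCompact K) : {z ∈ K | F z = 0}.Finite := by
  by_contra hinf
  obtain ⟨x, -, hx⟩ := Set.Infinite.exists_accPt_of_subset_isCompact hinf hK fun z hz => hz.1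
  rw [accPt_iff_frequently_nhdsNE] at hx
  have han : AnalyticOnNhd ℂ F univ := fun z _ => hF.analyticAt z
  exact hz₀ (han.eqOn_zero_of_preconnected_of_frequently_eq_zero isPreconnected_univ (mem_univ x)
    (hx.mono fun z hz => hz.2) (mem_univ z₀))

namespace IsAntiHerglotzPair

variable {f g : ℂ → ℂ} {Λ : ℝ}

open Classical in
lemma analyticOrderNatAt_left (h : IsAntiHerglotzPair f g Λ) {x : ℝ}
    (hx : analyticOrderNatAt g (x : ℂ) ≤ analyticOrderNatAt f (x : ℂ)) :
    analyticOrderNatAt f (x : ℂ) =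
      analyticOrderNatAt g (x : ℂ) + if realQuotient f g x = 0 then 1 else 0 := by
  obtain ⟨m, hm, hfm, hsign, hmx, -⟩ := h.exists_local_quotient hx
  obtain ⟨d, hd0, hd⟩ := deriv_neg_of_im_mul_im_neg hm hsign
  rw [analyticOrderNatAt_of_eq_mul (h.analyticAt_right x) hm (h.analyticOrderAt_right_ne_top x) hd
    (by exact_mod_cast hd0.ne) hfm, hmx]
  norm_cast

open Classical in
lemma analyticOrderNatAt_add_sqrt (h : IsAntiHerglotzPair f g Λ) {x : ℝ} (hx0 : x < 0)
    (hx : analyticOrderNatAt g (x : ℂ) ≤ analyticOrderNatAt f (x : ℂ)) :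
    analyticOrderNatAt (fun z => f z + Complex.sqrt (-z) * g z) (x : ℂ) =
      analyticOrderNatAt g (x : ℂ) + if realQuotient f g x + √(-x) = 0 then 1 else 0 := by
  obtain ⟨m, hm, hfm, hsign, hmx, -⟩ := h.exists_local_quotient hx
  have hs := analyticAt_sqrt_neg (z := (x : ℂ)) (by simpa using hx0)
  have hre : ∀ᶠ z in 𝓝 (x : ℂ), z.re < 0 :=
    Complex.continuous_re.continuousAt.eventually_lt continuousAt_const (by simpa using hx0)
  obtain ⟨d, hd0, hd⟩ := deriv_neg_of_im_mul_im_neg (hm.fun_add hs) (by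
    filter_upwards [hsign, hre] with z h1 h2 h3
    rw [Complex.add_im, add_mul]
    exact add_neg (h1 h3) (im_sqrt_neg_mul_im_neg h2 h3))
  rw [analyticOrderNatAt_of_eq_mul (h.analyticAt_right x) (hm.fun_add hs)
    (h.analyticOrderAt_right_ne_top x) hd (by exact_mod_cast hd0.ne) (by
      filter_upwards [hfm] with z hz
      rw [hz]
      ring), hmx, sqrt_neg_ofReal hx0]
  norm_cast

lemma analyticOrderNatAt_add_sqrt_of_pole (h : IsAntiHerglotzPair f g Λ) {x : ℝ} (hx0 : x < 0)
    (hx : analyticOrderNatAt f (x : ℂ) < analyticOrderNatAt g (x : ℂ)) :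
    analyticOrderNatAt (fun z => f z + Complex.sqrt (-z) * g z) (x : ℂ) =
      analyticOrderNatAt f (x : ℂ) := by
  obtain ⟨k, hk, hk0, hgk, -, -⟩ := h.exists_local_pole hx
  have hs := analyticAt_sqrt_neg (z := (x : ℂ)) (by simpa using hx0)
  have hu : AnalyticAt ℂ (fun z => 1 + Complex.sqrt (-z) * k z) x :=
    analyticAt_const.fun_add (hs.fun_mul hk)
  have hu0 : analyticOrderAt (fun z => 1 + Complex.sqrt (-z) * k z) (x : ℂ) = 0 :=
    hu.analyticOrderAt_eq_zero.2 (by simp [hk0])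
  have heq : (fun z => f z + Complex.sqrt (-z) * g z) =ᶠ[𝓝 (x : ℂ)]
      (fun z => 1 + Complex.sqrt (-z) * k z) * f := by
    filter_upwards [hgk] with z hz
    rw [Pi.mul_apply, hz]
    ring
  rw [analyticOrderNatAt, analyticOrderAt_congr heq, analyticOrderAt_mul hu (h.analyticAt_left x),
    hu0, zero_add, ← analyticOrderNatAt]

lemma finite_setOf_pole (h : IsAntiHerglotzPair f g Λ) :
    {x : ℝ | x < 0 ∧ analyticOrderNatAt f (x : ℂ) < analyticOrderNatAt g (x : ℂ)}.Finite := by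
  have hK : IsCompact ((fun x : ℝ => (x : ℂ)) '' Icc (-Λ) 0) :=
    isCompact_Icc.image Complex.continuous_ofReal
  refine Finite.subset ((finite_zeros_of_isCompact h.differentiable_right
    (h.ne_zero_of_im_ne_zero Complex.I (by simp)) hK).preimage
      Complex.ofReal_injective.injOn) fun x hx => ?_
  have hx0 : g x = 0 := apply_eq_zero_of_analyticOrderNatAt_ne_zero (Nat.ne_zero_of_lt hx.2)
  refine ⟨⟨x, ⟨?_, hx.1.le⟩, rfl⟩, hx0⟩
  by_contra! hlt
  exact h.ne_zero_of_re_le x (by simpa using hlt.le) hx0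

/-- The zeros of `f` and of `f + √(-z) g` on the negative half-axis have the same number, counted with
multiplicities: the orders differ by the simple zeros of `f / g` and of `f / g + √(-z)` only. -/
theorem finsum_analyticOrderNatAt_add_sqrt (h : IsAntiHerglotzPair f g Λ)
    (h0 : {x : ℝ | x < 0 ∧ f x = 0}.Finite)
    (h1 : {x : ℝ | x < 0 ∧ f x + Complex.sqrt (-x) * g x = 0}.Finite) :
    ∑ᶠ x ∈ {x : ℝ | x < 0 ∧ f x + Complex.sqrt (-x) * g x = 0},
        analyticOrderNatAt (fun z => f z + Complex.sqrt (-z) * g z) (x : ℂ) =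
      ∑ᶠ x ∈ {x : ℝ | x < 0 ∧ f x = 0}, analyticOrderNatAt f (x : ℂ) := by
  classical
  set e : ℂ → ℂ := fun z => f z + Complex.sqrt (-z) * g z with he
  set P : Set ℝ := {x : ℝ | x < 0 ∧ analyticOrderNatAt f (x : ℂ) < analyticOrderNatAt g (x : ℂ)}
    with hP
  set m := realQuotient f g with hm
  set Z₀ : Set ℝ := {x | x < 0 ∧ x ∉ P ∧ m x = 0} with hZ₀
  set Z₁ : Set ℝ := {x | x < 0 ∧ x ∉ P ∧ m x + √(-x) = 0} with hZ₁
  have hreg : ∀ x : ℝ, x < 0 → x ∉ P →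
      analyticOrderNatAt g (x : ℂ) ≤ analyticOrderNatAt f (x : ℂ) :=
    fun x hx hxP => not_lt.1 fun hlt => hxP ⟨hx, hlt⟩
  have hcard : Z₀.ncard = Z₁.ncard := by
    refine ncard_zeros_eq_ncard_zeros_add_sqrt (Λ := Λ) h.finite_setOf_pole (fun x hx hxP => ?_)
      (fun p hp => ?_) (fun p hp => ?_) fun x hx => h.realQuotient_pos hx
    · obtain ⟨-, -, -, -, -, d, hd⟩ := h.exists_local_quotient (hreg x hx hxP)
      exact ⟨d, hd⟩
    · obtain ⟨-, -, -, -, hl, -⟩ := h.exists_local_pole hp.2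
      exact hl
    · obtain ⟨-, -, -, -, -, hr⟩ := h.exists_local_pole hp.2
      exact hr
  -- the common part of the two orders
  set c : ℝ → ℕ := fun x =>
    if x ∈ P then analyticOrderNatAt f (x : ℂ) else analyticOrderNatAt g (x : ℂ) with hc
  have hord₀ : ∀ x : ℝ, x < 0 →
      analyticOrderNatAt f (x : ℂ) = c x + if x ∈ Z₀ then 1 else 0 := by
    intro x hx
    by_cases hxP : x ∈ P
    · simp [hc, hxP, hZ₀]
    · simp only [hc, hZ₀, hxP, mem_ofPred_eq, hx, not_false_eq_true, true_and, if_false]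
      exact h.analyticOrderNatAt_left (hreg x hx hxP)
  have hord₁ : ∀ x : ℝ, x < 0 →
      analyticOrderNatAt e (x : ℂ) = c x + if x ∈ Z₁ then 1 else 0 := by
    intro x hx
    by_cases hxP : x ∈ P
    · simp only [hc, hxP, hZ₁, mem_ofPred_eq, not_true_eq_false, false_and, and_false, if_true,
        if_false, add_zero]
      exact h.analyticOrderNatAt_add_sqrt_of_pole hx hxP.2
    · simp only [hc, hZ₁, hxP, mem_ofPred_eq, hx, not_false_eq_true, true_and, if_false]
      exact h.analyticOrderNatAt_add_sqrt hx (hreg x hx hxP)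
  have hsum : ∀ (F : ℂ → ℂ) (Z : Set ℝ) [DecidablePred (· ∈ Z)] (T : Finset ℝ)
      (hF : {x : ℝ | x < 0 ∧ F x = 0}.Finite),
      hF.toFinset ⊆ T → (∀ x ∈ T, x < 0) → (∀ x ∈ Z, x < 0) →
      (∀ x : ℝ, x < 0 → analyticOrderNatAt F (x : ℂ) = c x + if x ∈ Z then 1 else 0) →
      ∑ᶠ x ∈ {x : ℝ | x < 0 ∧ F x = 0}, analyticOrderNatAt F (x : ℂ) =
        ∑ x ∈ T, c x + Z.ncard := by
    intro F Z _ T hF hFT hT hZ hord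
    have h2 : (T.filter (· ∈ Z) : Set ℝ) = Z := by
      ext x
      simp only [Finset.coe_filter, mem_ofPred_eq, and_iff_right_iff_imp]
      intro hx
      refine hFT (hF.mem_toFinset.2 ⟨hZ x hx, apply_eq_zero_of_analyticOrderNatAt_ne_zero ?_⟩)
      rw [hord x (hZ x hx), if_pos hx]
      omega
    rw [finsum_mem_eq_finite_toFinset_sum _ hF, Finset.sum_subset hFT,
      Finset.sum_congr rfl fun x hx => hord x (hT x hx), Finset.sum_add_distrib,
      ← Finset.card_filter, ← ncard_coe_finset, h2]
    intro x hxT hx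
    by_contra hne
    exact hx (hF.mem_toFinset.2 ⟨hT x hxT, apply_eq_zero_of_analyticOrderNatAt_ne_zero hne⟩)
  have hT : ∀ x ∈ h0.toFinset ∪ h1.toFinset, x < 0 := by
    intro x hx
    rcases Finset.mem_union.1 hx with hx | hx
    · exact (h0.mem_toFinset.1 hx).1
    · exact (h1.mem_toFinset.1 hx).1
  rw [hsum f Z₀ _ h0 Finset.subset_union_left hT (fun x hx => hx.1) hord₀, hcard]
  exact hsum e Z₁ _ h1 Finset.subset_union_right hT (fun x hx => hx.1) hord₁

lemma finite_zeros_left (h : IsAntiHerglotzPair f g Λ) :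
    {z : ℂ | z.im = 0 ∧ z.re < 0 ∧ f z = 0}.Finite := by
  have hK : IsCompact ((fun x : ℝ => (x : ℂ)) '' Icc (-Λ) 0) :=
    isCompact_Icc.image Complex.continuous_ofReal
  refine (finite_zeros_of_isCompact h.differentiable_left
    (h.ne_zero_left (z := Complex.I) (by simp)) hK).subset fun z hz => ?_
  refine ⟨⟨z.re, ⟨?_, hz.2.1.le⟩, Complex.ext rfl hz.1.symm⟩, hz.2.2⟩
  by_contra! hlt
  have := h.re_pos z hlt.le
  simp [hz.2.2] at this

lemma ne_zero_of_re_ne_zero (h : IsAntiHerglotzPair f g Λ) {τ : ℂ} (him : τ.im < 0)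
    (hre : τ.re ≠ 0) : f (τ ^ 2) + Complex.I * τ * g (τ ^ 2) ≠ 0 := by
  intro h0
  have h1 : (τ ^ 2).im = 2 * τ.re * τ.im := by simp [sq]; ring
  have h2 : (τ ^ 2).im ≠ 0 := by
    rw [h1]
    exact mul_ne_zero (mul_ne_zero two_ne_zero hre) him.ne
  have h3 : f (τ ^ 2) / g (τ ^ 2) = -(Complex.I * τ) := by
    rw [div_eq_iff (h.ne_zero_of_im_ne_zero _ h2)]
    linear_combination h0
  have h4 := h.im_mul_im_neg _ h2
  rw [h3, h1] at h4
  simp at h4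
  have : 0 < τ.re ^ 2 * (-τ.im) := mul_pos (by positivity) (by linarith)
  nlinarith

lemma ne_zero_of_im_le (h : IsAntiHerglotzPair f g Λ) {τ : ℂ} (hre : τ.re = 0)
    (him : τ.im < 0) (hΛ : Λ ≤ τ.im ^ 2) : f (τ ^ 2) + Complex.I * τ * g (τ ^ 2) ≠ 0 := by
  intro h0
  have h1 : (τ ^ 2).re ≤ -Λ := by
    simp only [sq, Complex.mul_re, hre] at hΛ ⊢
    linarith
  have h3 : f (τ ^ 2) / g (τ ^ 2) = -(Complex.I * τ) := by
    rw [div_eq_iff (h.ne_zero_of_re_le _ h1)]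
    linear_combination h0
  have h4 := h.re_pos _ h1
  rw [h3] at h4
  simp at h4
  linarith

theorem exists_bound_zeros (h : IsAntiHerglotzPair f g Λ) :
    ∃ R : ℝ, 0 < R ∧ ∀ τ : ℂ, f (τ ^ 2) + Complex.I * τ * g (τ ^ 2) = 0 →
      0 ≤ τ.im ∨ (τ.re = 0 ∧ -R < τ.im ∧ τ.im < 0) := by
  refine ⟨√|Λ| + 1, by positivity, fun τ h0 => ?_⟩
  rcases le_or_gt 0 τ.im with him | him
  · exact Or.inl him
  have hre : τ.re = 0 := by
    by_contra hre
    exact h.ne_zero_of_re_ne_zero him hre h0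
  refine Or.inr ⟨hre, ?_, him⟩
  by_contra! hle
  refine h.ne_zero_of_im_le hre him ?_ h0
  have h1 : √|Λ| ≤ -τ.im := by linarith
  have h2 := Real.sq_sqrt (abs_nonneg Λ)
  have h3 : √|Λ| ^ 2 ≤ (-τ.im) ^ 2 := pow_le_pow_left₀ (Real.sqrt_nonneg _) h1 2
  rw [neg_sq, h2] at h3
  exact (le_abs_self Λ).trans h3

theorem finite_zeros_jost (h : IsAntiHerglotzPair f g Λ) :
    {τ : ℂ | τ.re = 0 ∧ τ.im < 0 ∧ f (τ ^ 2) + Complex.I * τ * g (τ ^ 2) = 0}.Finite := by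
  obtain ⟨R, hR, hzero⟩ := h.exists_bound_zeros
  have hE : Differentiable ℂ fun τ : ℂ => f (τ ^ 2) + Complex.I * τ * g (τ ^ 2) := by
    have := h.differentiable_left
    have := h.differentiable_right
    fun_prop
  refine (finite_zeros_of_isCompact hE (h.ne_zero_of_re_ne_zero (τ := 1 - Complex.I) (by simp)
    (by simp)) (isCompact_closedBall 0 R)).subset fun τ hτ => ⟨?_, hτ.2.2⟩
  rcases hzero τ hτ.2.2 with h1 | ⟨-, h1, -⟩
  · exact absurd hτ.2.1 (not_lt.2 h1)
  · rw [mem_closedBall_zero_iff]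
    refine (Complex.norm_le_abs_re_add_abs_im τ).trans ?_
    rw [hτ.1, abs_zero, zero_add, abs_of_neg hτ.2.1]
    linarith

/-- For `Im τ < 0` the function `f (τ²) + iτ g (τ²)` is the composition of `f + √(-z) g` with the
square, which is locally injective away from `0` and therefore preserves orders. -/
theorem finsum_analyticOrderNatAt_jost (h : IsAntiHerglotzPair f g Λ) :
    ∑ᶠ τ ∈ {τ : ℂ | τ.re = 0 ∧ τ.im < 0 ∧ f (τ ^ 2) + Complex.I * τ * g (τ ^ 2) = 0},
        analyticOrderNatAt (fun τ => f (τ ^ 2) + Complex.I * τ * g (τ ^ 2)) τ =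
      ∑ᶠ z ∈ {z : ℂ | z.im = 0 ∧ z.re < 0 ∧ f z = 0}, analyticOrderNatAt f z := by
  set e : ℂ → ℂ := fun z => f z + Complex.sqrt (-z) * g z with he
  have hE : ∀ τ : ℂ, τ.im < 0 → f (τ ^ 2) + Complex.I * τ * g (τ ^ 2) = e (τ ^ 2) := by
    intro τ hτ
    simp only [he, sqrt_neg_sq hτ]
  have hb₀ : BijOn (fun x : ℝ => (x : ℂ)) {x : ℝ | x < 0 ∧ f x = 0}
      {z : ℂ | z.im = 0 ∧ z.re < 0 ∧ f z = 0} := by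
    refine ⟨fun x hx => ⟨by simp, by simpa using hx.1, hx.2⟩, Complex.ofReal_injective.injOn,
      fun z hz => ⟨z.re, ⟨hz.2.1, ?_⟩, Complex.ext rfl hz.1.symm⟩⟩
    have : ((z.re : ℝ) : ℂ) = z := Complex.ext rfl hz.1.symm
    rw [this]
    exact hz.2.2
  have hsq : ∀ τ : ℂ, τ.re = 0 → τ ^ 2 = ((-τ.im ^ 2 : ℝ) : ℂ) := by
    intro τ hτ
    apply Complex.ext <;> simp [sq, hτ]
  have hb₁ : BijOn (fun τ : ℂ => -τ.im ^ 2)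
      {τ : ℂ | τ.re = 0 ∧ τ.im < 0 ∧ f (τ ^ 2) + Complex.I * τ * g (τ ^ 2) = 0}
      {x : ℝ | x < 0 ∧ e x = 0} := by
    refine ⟨fun τ hτ => ⟨?_, ?_⟩, fun τ hτ σ hσ hτσ => ?_, fun x hx => ?_⟩
    · have : 0 < τ.im ^ 2 := sq_pos_of_neg hτ.2.1
      simpa using this
    · rw [← hsq τ hτ.1, ← hE τ hτ.2.1]
      exact hτ.2.2
    · refine Complex.ext (hτ.1.trans hσ.1.symm) ?_
      have h1 : τ.im ^ 2 = σ.im ^ 2 := neg_injective hτσ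
      have h2 := hτ.2.1
      have h3 := hσ.2.1
      rcases sq_eq_sq_iff_eq_or_eq_neg.1 h1 with h4 | h4
      · exact h4
      · linarith
    · have hx0 : 0 < √(-x) := Real.sqrt_pos.2 (by linarith [hx.1])
      have him : (-(√(-x) : ℝ) * Complex.I : ℂ).im = -√(-x) := by simp
      have hre : (-(√(-x) : ℝ) * Complex.I : ℂ).re = 0 := by simp
      have hxx : -(-√(-x)) ^ 2 = x := by
        rw [neg_sq, Real.sq_sqrt (by linarith [hx.1]), neg_neg]
      refine ⟨-(√(-x) : ℝ) * Complex.I, ⟨hre, by rw [him]; linarith, ?_⟩, ?_⟩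
      · rw [hE _ (by rw [him]; linarith), hsq _ hre, him, hxx]
        exact hx.2
      · simp only [him, hxx]
  have h0 : {x : ℝ | x < 0 ∧ f x = 0}.Finite := hb₀.finite_iff_finite.2 h.finite_zeros_left
  have h1 : {x : ℝ | x < 0 ∧ e x = 0}.Finite := hb₁.finite_iff_finite.1 h.finite_zeros_jost
  rw [← finsum_mem_eq_of_bijOn _ hb₀ fun x _ => rfl,
    ← h.finsum_analyticOrderNatAt_add_sqrt h0 h1]
  refine finsum_mem_eq_of_bijOn _ hb₁ fun τ hτ => ?_
  rw [← hsq τ hτ.1]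
  have hlt : ∀ᶠ σ in 𝓝 τ, σ.im < 0 :=
    Complex.continuous_im.continuousAt.eventually_lt continuousAt_const hτ.2.1
  have heq : (fun τ => f (τ ^ 2) + Complex.I * τ * g (τ ^ 2)) =ᶠ[𝓝 τ] e ∘ fun σ => σ ^ 2 := by
    filter_upwards [hlt] with σ hσ
    exact hE σ hσ
  rw [analyticOrderNatAt, analyticOrderAt_congr heq,
    analyticOrderAt_comp_of_deriv_ne_zero (by fun_prop), ← analyticOrderNatAt]
  have : τ ≠ 0 := by
    rintro rfl
    simpa using hτ.2.1
  simpa using this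

end IsAntiHerglotzPair
end TreeJost

theorem theorem4p2 {V : Type*} [Fintype V] [DecidableEq V] [Nontrivial V]
    (G : SimpleGraph V) (hG : G.IsTree) (r : V) (l : ℝ) (hl : 0 < l)
    (q : {v : V // v ≠ r} → ℝ → ℝ)
    (hq : ∀ v, MemLp (q v) 2 (volume.restrict (Set.Ioo 0 l))) :
    -- `phiN` and the Jost function are entire, so multiplicities of zeros are meaningful
    Differentiable ℂ (phiN G r l q) ∧ Differentiable ℂ (jost G r l q) ∧
    -- location of the zeros
    (∃ R : ℝ, 0 < R ∧ ∀ τ : ℂ, jost G r l q τ = 0 →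
      0 ≤ τ.im ∨ (τ.re = 0 ∧ -R < τ.im ∧ τ.im < 0)) ∧
    -- the two numbers of zeros, counted with multiplicities, are finite and equal
    (jostNegZeros G r l q).Finite ∧ (phiNNegZeros G r l q).Finite ∧
    ∑ᶠ τ ∈ jostNegZeros G r l q, analyticOrderNatAt (jost G r l q) τ =
      ∑ᶠ lam ∈ phiNNegZeros G r l q, analyticOrderNatAt (phiN G r l q) lam := by
  have hq' : ∀ v, IntervalIntegrable (q v) volume 0 l := fun v => by
    rw [intervalIntegrable_iff_integrableOn_Ioo_of_le hl.le]
    exact (hq v).integrable one_le_two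
  have hN := TreeJost.differentiable_phiN (G := G) hl hq'
  have hD := TreeJost.differentiable_phiD (G := G) hl hq'
  obtain ⟨Λ, hΛ⟩ := TreeJost.phiD_ne_zero_and_energy (G := G) hG.connected hl hq'
  have h : TreeJost.IsAntiHerglotzPair (phiN G r l q) (phiD G r l q) Λ :=
    { differentiable_left := hN
      differentiable_right := hD
      ne_zero_of_im_ne_zero := fun z hz => (hΛ z (Or.inl hz)).1
      im_mul_im_neg := fun z hz => by
        obtain ⟨-, S, hS, him, -⟩ := hΛ z (Or.inl hz)
        rw [him]
        have : 0 < z.im ^ 2 * S := by positivity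
        linarith
      ne_zero_of_re_le := fun z hz => (hΛ z (Or.inr hz)).1
      re_pos := fun z hz => by
        obtain ⟨-, S, hS, -, hre⟩ := hΛ z (Or.inr hz)
        exact hre hz }
  refine ⟨hN, ?_, h.exists_bound_zeros, h.finite_zeros_jost, h.finite_zeros_left,
    h.finsum_analyticOrderNatAt_jost⟩
  unfold jost
  fun_prop
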